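/- **Conventions.** All rings are commutative with $1$ and ring homomorphisms are unital. For an element $a$ of a lattice-ordered ring, $|a|=a\vee(-a)$. *Nachbin spaces.* $\mathsf{Nach}$ is the category of compact spaces $X$ with a partial order that is closed in $X\times X$, and continuous order-preserving maps. *Bounded archimedean $\ell$-algebras.* Let $A$ be an $\mathbb R$-algebra with a lattice order such that $a\le b$ implies $a+c\le b+c$; $0\le a,b$ implies $0\le ab$; and $0\le a$, $0\le r\in\mathbb R$ imply $0\le ra$. Then $A$ is a $ba\ell$-algebra if for each $a$ there is $n\in\mathbb N$ with $-n\cdot 1\le a\le n\cdot 1$, and $na\le b$ for all $n\in\mathbb N$ implies $a\le 0$. Reals $r$ are identified with $r\cdot 1$, and $\|a\|=\inf\{r\in\mathbb R:|a|\le r\}$. A $ba\ell$-morphism is a unital $\mathbb R$-algebra homomorphism that is a lattice homomorphism. *Proximities.* A reflexive proximity on a $ba\ell$-algebra $A$ is a binary relation $\prec$ such that: $a\prec b$ implies $a\le b$; $a\le b\prec c\le d$ implies $a\prec d$; $a\prec b,c$ implies $a\prec b\wedge c$; $a,b\prec c$ implies $a\vee b\prec c$; $a\prec b$ and $c\prec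 d$ imply $a+c\prec b+d$, and also $ac\prec bd$ if $a,b,c,d\ge 0$; $r\prec r$ for $r\in\mathbb R$; $a\prec b$ and $0\le r\in\mathbb R$ imply $ra\prec rb$; and $a\prec b$ implies that there is $c$ with $c\prec c$ and $a\prec c\prec b$. An element $c$ is reflexive if $c\prec c$. The proximity is a Nachbin proximity if $\{c-d: c,d\text{ reflexive}\}$ (which is the $\ell$-subalgebra generated by the reflexive elements) is dense in $A$ for $\|\cdot\|$. $\boldsymbol{nba\ell}$ is the category of pairs $(A,\prec)$ of a $ba\ell$-algebra and a Nachbin proximity on it; its morphisms are the $ba\ell$-morphisms that preserve $\prec$. *Semialgebras.* An object of $\boldsymbol{sbal}$ is a commutative monoid $(S,+,0)$ with a lattice order such that for all $a,b,c,d$: $a\le b\iff a+c\le b+c$; $(a\vee b)+c=(a+c)\vee(b+c)$; $(a\wedge b)+c=(a+c)\wedge(b+c)$; on $S^+=\{a:a\ge0\}$ there is a commutative associative multiplication with identity $1$, which distributes over $+$ and satisfies $ac\le bc$ whenever $a\le b$ (in $S^+$); there is a map $\rho:\mathbb R\to S$ that preserves $+,\vee,\wedge$, $1$ and products of nonnegative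 reals (write $r$ for $\rho(r)$, and $a-r$ for $a+(-r)$); for each $a$ there is $r\ge 0$ in $\mathbb R$ with $-r\le a\le r$; and $na+b\le nc+d$ for all $n\in\mathbb N$ implies $a\le c$. Nonnegative reals act on $S$ by $ra=r(a+s)-rs$ for any real $s\ge 0$ with $a+s\ge0$. Morphisms preserve $+,\vee,\wedge$, $1$, multiplication on $S^+$ and the action of nonnegative reals. *The functors from $\mathsf{Nach}$.* $\mathscr C X=(C(X),\prec_X)$, where $C(X)$ is the algebra of continuous functions $X\to\mathbb R$ and $f\prec_X g$ iff $f\le c\le g$ for some continuous order-preserving $c:X\to\mathbb R$. $\mathscr C_\le X=C_\le(X)\in\boldsymbol{sbal}$ is the set of continuous order-preserving functions $X\to\mathbb R$ with pointwise operations and order. Both send a morphism $\varphi$ to composition with $\varphi$. *The functor $\mathscr X$.* An ideal $I$ of $A$ is an $\ell$-ideal if $|a|\le|b|$, $b\in I$ imply $a\in I$. For $(A,\prec)\in\boldsymbol{nba\ell}$, $\mathscr X(A,\prec)$ is the set $X_A$ of maximal (proper) $\ell$-ideals of $A$, with closed sets $\{x: I\subseteq x\}$ for $\ell$-ideals $I$,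 and with the order $$x\le y\iff \{a\in A:\ |a|\le c\text{ for some } c\in y\text{ with } c\ge 0,\ c\prec c\}\subseteq x .$$ A morphism $\alpha$ is sent to $\alpha^{-1}$. *The functor $\mathscr Y$.* For $S\in\boldsymbol{sbal}$ the envelope $\mathscr B S$ is the set of classes $[a,b]$ of pairs in $S\times S$ under $(a,b)\sim(c,d)\iff a+d=b+c$. It is an $\mathbb R$-algebra with $[a,b]+[c,d]=[a+c,b+d]$, with $[a,b][c,d]=[ac+bd,ad+bc]$ for $a,b,c,d\ge0$, and with $r[a,b]=[ra,rb]$, $-r[a,b]=[rb,ra]$ for $r\ge0$; it is lattice-ordered by $[a,b]\le[c,d]\iff a+d\le c+b$. Let $\varepsilon(s)=[s,0]$, and let $x\prec_S y$ iff $x\le\varepsilon(s)\le y$ for some $s\in S$. Then $\mathscr Y S$ is defined from $(\mathscr BS,\prec_S)$ by exactly the same construction as $\mathscr X(A,\prec)$ is from $(A,\prec)$: the set of maximal $\ell$-ideals of $\mathscr B S$, with the topology and order given by the same formulas. (If $\mathscr B S$ is a $ba\ell$-algebra, then $(\mathscr BS,\prec_S)\in\boldsymbol{nba\ell}$ and $\mathscr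 YS=\mathscr X(\mathscr BS,\prec_S)$.) A morphism $\alpha:S\to T$ is sent to the preimage map of $[a,b]\mapsto[\alpha(a),\alpha(b)]$. **Theorem.** 1. The contravariant functors $\mathscr C:\mathsf{Nach}\to\boldsymbol{nba\ell}$ and $\mathscr X:\boldsymbol{nba\ell}\to\mathsf{Nach}$ form a contravariant adjunction (adjoint on the right) whose units $\phi:1\to\mathscr C\mathscr X$ and $\eta:1\to\mathscr X\mathscr C$ are given as follows: $\phi_A(a)(x)$ is the real number $r$ with $a-r\in x$, and $\eta_X(x)=\{f\in C(X): f(x)=0\}$. Moreover, $\eta$ is a natural isomorphism. 2. The contravariant functors $\mathscr C_\le:\mathsf{Nach}\to\boldsymbol{sbal}$ and $\mathscr Y:\boldsymbol{sbal}\to\mathsf{Nach}$ form a contravariant adjunction (adjoint on the right) whose units $\psi:1\to\mathscr C_\le\mathscr Y$ and $\zeta:1\to\mathscr Y\mathscr C_\le$ are given as follows: $\psi_S(s)(y)$ is the real number $r$ with $\varepsilon(s)-r\in y$, and $\zeta_X(x)=\{[f,g]\in\mathscr B C_\le(X): f(x)=g(x)\}$. Moreover, $\zeta$ is a natural isomorphism.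 -/

import Mathlib

open CategoryTheory Opposite

universe u v w

namespace NachbinDuality

set_option linter.unusedSectionVars false

/-! ### Bounded archimedean lattice-ordered algebras -/

/-- The axioms of a bounded archimedean `ℓ`-algebra: a commutative real algebra with a
lattice order for which sums and products of nonnegative elements and nonnegative multiples of
nonnegative elements behave as expected, `1` is a strong order unit, and there are no nonzero
infinitesimals. -/
class IsBal (A : Type u) [CommRing A] [Lattice A] [Algebra ℝ A] : Prop where
  add_le_add_right' : ∀ a b c : A, a ≤ b → a + c ≤ b + c
  mul_nonneg' : ∀ a b : A, 0 ≤ a → 0 ≤ b → 0 ≤ a * b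
  smul_nonneg' : ∀ (r : ℝ) (a : A), 0 ≤ r → 0 ≤ a → 0 ≤ r • a
  bounded' : ∀ a : A, ∃ n : ℕ, -(n : A) ≤ a ∧ a ≤ (n : A)
  archimedean' : ∀ a b : A, (∀ n : ℕ, n • a ≤ b) → a ≤ 0

/-- An auxiliary weakening of the axioms, used only to construct spaces of maximal `ℓ`-ideals:
instead of nonnegativity of all products of nonnegative elements it asks that products with the
nonnegative elements of some set `T` of generators are nonnegative. It also holds for the envelopes
of the semialgebras defined below. -/
class IsWeakBal (A : Type u) [CommRing A] [Lattice A] [Algebra ℝ A] : Prop where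
  add_le_add_right' : ∀ a b c : A, a ≤ b → a + c ≤ b + c
  smul_nonneg' : ∀ (r : ℝ) (a : A), 0 ≤ r → 0 ≤ a → 0 ≤ r • a
  bounded' : ∀ a : A, ∃ n : ℕ, -(n : A) ≤ a ∧ a ≤ (n : A)
  exists_cone' : ∃ T : Set A, (∀ a ∈ T, ∀ r : ℝ, a + algebraMap ℝ A r ∈ T) ∧
    (∀ a ∈ T, a ⊔ 0 ∈ T) ∧ (∀ t ∈ T, 0 ≤ t → ∀ a, 0 ≤ a → 0 ≤ t * a) ∧
    ∀ a, ∃ c ∈ T, ∃ d ∈ T, a = c - d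

section Bal

variable {A : Type u} [CommRing A] [Lattice A] [Algebra ℝ A]

instance [IsBal A] : IsWeakBal A where
  add_le_add_right' := IsBal.add_le_add_right'
  smul_nonneg' := IsBal.smul_nonneg'
  bounded' := IsBal.bounded'
  exists_cone' := ⟨Set.univ, fun _ _ _ => trivial, fun _ _ => trivial,
    fun t _ ht a ha => IsBal.mul_nonneg' t a ht ha, fun a => ⟨a, trivial, 0, trivial, by simp⟩⟩

section

variable [IsWeakBal A]

instance : IsOrderedAddMonoid A where
  add_le_add_left a b h c := IsWeakBal.add_le_add_right' a b c h

theorem bal_zero_le_one : (0 : A) ≤ 1 := by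
  obtain ⟨n, h1, h2⟩ := IsWeakBal.bounded' (1 : A)
  rcases Nat.eq_zero_or_pos n with rfl | hn
  · simpa using h1
  · have h3 : (0 : A) ≤ (2 * n : ℝ) • (1 : A) := by
      have : (0 : A) ≤ n + n := by
        have h4 := add_le_add (h1.trans h2) (le_refl (n : A))
        simpa using h4
      have e : (2 * n : ℝ) • (1 : A) = (n : A) + n := by
        rw [← Algebra.algebraMap_eq_smul_one, map_mul, map_natCast, map_ofNat]; ring
      rwa [e]
    have h5 := IsWeakBal.smul_nonneg' (2 * n : ℝ)⁻¹ _ (by positivity) h3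
    rwa [smul_smul, inv_mul_cancel₀ (by positivity), one_smul] at h5

theorem smul_mono {r : ℝ} (hr : 0 ≤ r) {a b : A} (h : a ≤ b) : r • a ≤ r • b := by
  have := IsWeakBal.smul_nonneg' r (b - a) hr (sub_nonneg.2 h)
  rw [smul_sub] at this
  exact sub_nonneg.1 this

theorem algebraMap_mono {r s : ℝ} (h : r ≤ s) : algebraMap ℝ A r ≤ algebraMap ℝ A s := by
  have := IsWeakBal.smul_nonneg' (A := A) (s - r) 1 (sub_nonneg.2 h) bal_zero_le_one
  rw [← Algebra.algebraMap_eq_smul_one, map_sub] at this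
  exact sub_nonneg.1 this

theorem algebraMap_nonneg' {r : ℝ} (h : 0 ≤ r) : 0 ≤ algebraMap ℝ A r := by
  simpa using algebraMap_mono (A := A) h

theorem exists_abs_le (a : A) : ∃ r : ℝ, 0 < r ∧ |a| ≤ algebraMap ℝ A r := by
  obtain ⟨n, h1, h2⟩ := IsWeakBal.bounded' a
  refine ⟨n + 1, by positivity, ?_⟩
  have h3 : (n : A) ≤ algebraMap ℝ A (n + 1) := by
    have := algebraMap_mono (A := A) (show (n : ℝ) ≤ n + 1 by linarith)
    rwa [map_natCast] at this
  exact (sup_le h2 (by simpa using neg_le_neg h1)).trans h3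

/-- A generating set as in the axioms. -/
def cone (A : Type u) [CommRing A] [Lattice A] [Algebra ℝ A] [IsWeakBal A] : Set A :=
  (IsWeakBal.exists_cone' (A := A)).choose

theorem cone_add {a : A} (ha : a ∈ cone A) (r : ℝ) : a + algebraMap ℝ A r ∈ cone A :=
  (IsWeakBal.exists_cone' (A := A)).choose_spec.1 a ha r

theorem cone_posPart {a : A} (ha : a ∈ cone A) : a⁺ ∈ cone A :=
  (IsWeakBal.exists_cone' (A := A)).choose_spec.2.1 a ha

theorem cone_mul_nonneg {t a : A} (ht : t ∈ cone A) (h0 : 0 ≤ t) (ha : 0 ≤ a) : 0 ≤ t * a :=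
  (IsWeakBal.exists_cone' (A := A)).choose_spec.2.2.1 t ht h0 a ha

theorem cone_mul_mono {t a b : A} (ht : t ∈ cone A) (h0 : 0 ≤ t) (h : a ≤ b) : t * a ≤ t * b := by
  have := cone_mul_nonneg ht h0 (sub_nonneg.2 h)
  rw [mul_sub] at this
  exact sub_nonneg.1 this

theorem cone_exists (a : A) : ∃ c ∈ cone A, ∃ d ∈ cone A, a = c - d :=
  (IsWeakBal.exists_cone' (A := A)).choose_spec.2.2.2 a

theorem cone_exists_nonneg (a : A) :
    ∃ c ∈ cone A, ∃ d ∈ cone A, 0 ≤ c ∧ 0 ≤ d ∧ a = c - d := by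
  obtain ⟨c, hc, d, hd, rfl⟩ := cone_exists a
  obtain ⟨r, hr, h1⟩ := exists_abs_le c
  obtain ⟨s, hs, h2⟩ := exists_abs_le d
  have h3 : ∀ (b : A) (t : ℝ), |b| ≤ algebraMap ℝ A t → t ≤ r + s →
      0 ≤ b + algebraMap ℝ A (r + s) := fun b t hb ht => by
    have := (neg_le_abs b).trans (hb.trans (algebraMap_mono ht))
    have h4 := add_le_add (le_refl b) this
    rwa [add_neg_cancel] at h4
  exact ⟨_, cone_add hc (r + s), _, cone_add hd (r + s), h3 c r h1 (by linarith),
    h3 d s h2 (by linarith), by ring⟩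

theorem cone_abs_mul_le {t : A} (ht : t ∈ cone A) (h0 : 0 ≤ t) (a : A) : |t * a| ≤ t * |a| := by
  refine sup_le (cone_mul_mono ht h0 (le_abs_self a)) ?_
  rw [← mul_neg]
  exact cone_mul_mono ht h0 (neg_le_abs a)

end

instance [IsBal A] : IsOrderedRing A :=
  { zero_le_one := bal_zero_le_one
    mul_le_mul_of_nonneg_left := fun a ha b c h => by
      have := IsBal.mul_nonneg' a (c - b) ha (sub_nonneg.2 h)
      rw [mul_sub] at this
      exact sub_nonneg.1 this
    mul_le_mul_of_nonneg_right := fun a ha b c h => by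
      have := IsBal.mul_nonneg' (c - b) a (sub_nonneg.2 h) ha
      rw [sub_mul] at this
      exact sub_nonneg.1 this }

end Bal

/-! ### Unital `ℓ`-algebra homomorphisms -/

/-- Unital `ℓ`-algebra homomorphisms. -/
@[ext]
structure BalHom (A : Type u) (B : Type v) [CommRing A] [Lattice A] [Algebra ℝ A]
    [CommRing B] [Lattice B] [Algebra ℝ B] extends A →ₐ[ℝ] B where
  map_sup' : ∀ a b, toFun (a ⊔ b) = toFun a ⊔ toFun b
  map_inf' : ∀ a b, toFun (a ⊓ b) = toFun a ⊓ toFun b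

namespace BalHom

variable {A : Type u} {B : Type v} {C : Type w} [CommRing A] [Lattice A] [Algebra ℝ A]
  [CommRing B] [Lattice B] [Algebra ℝ B] [CommRing C] [Lattice C] [Algebra ℝ C]

theorem map_sup (f : BalHom A B) (a b : A) :
    f.toAlgHom (a ⊔ b) = f.toAlgHom a ⊔ f.toAlgHom b := f.map_sup' a b

theorem map_inf (f : BalHom A B) (a b : A) :
    f.toAlgHom (a ⊓ b) = f.toAlgHom a ⊓ f.toAlgHom b := f.map_inf' a b

theorem monotone (f : BalHom A B) : Monotone f.toAlgHom := fun a b h => by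
  rw [← sup_eq_right, ← f.map_sup, sup_eq_right.2 h]

theorem map_abs (f : BalHom A B) (a : A) : f.toAlgHom |a| = |f.toAlgHom a| := by
  rw [abs, abs, f.map_sup, map_neg]

/-- The identity homomorphism. -/
def id (A : Type u) [CommRing A] [Lattice A] [Algebra ℝ A] : BalHom A A where
  toAlgHom := AlgHom.id ℝ A
  map_sup' _ _ := rfl
  map_inf' _ _ := rfl

/-- Composition, `g` after `f`. -/
def comp (g : BalHom B C) (f : BalHom A B) : BalHom A C where
  toAlgHom := g.toAlgHom.comp f.toAlgHom
  map_sup' a b := by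
    change g.toAlgHom (f.toAlgHom (a ⊔ b)) = _
    rw [f.map_sup, g.map_sup]; rfl
  map_inf' a b := by
    change g.toAlgHom (f.toAlgHom (a ⊓ b)) = _
    rw [f.map_inf, g.map_inf]; rfl

end BalHom

/-! ### The space of maximal `ℓ`-ideals -/

/-- `ℓ`-ideals: ideals `I` such that `|a| ≤ |b|` and `b ∈ I` imply `a ∈ I`. -/
def IsLIdeal {A : Type u} [CommRing A] [Lattice A] (I : Ideal A) : Prop :=
  ∀ a b : A, |a| ≤ |b| → b ∈ I → a ∈ I

/-- The set of maximal `ℓ`-ideals of `A`: the proper `ℓ`-ideals that are maximal among proper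
`ℓ`-ideals. -/
@[ext]
structure MaxLIdeal (A : Type u) [CommRing A] [Lattice A] where
  ideal : Ideal A
  isLIdeal : IsLIdeal ideal
  ne_top : ideal ≠ ⊤
  maximal : ∀ J : Ideal A, IsLIdeal J → J ≠ ⊤ → ideal ≤ J → J = ideal

namespace MaxLIdeal

section

variable {A : Type u} [CommRing A] [Lattice A] [Algebra ℝ A] [IsWeakBal A]

/-- A criterion for a set to be an ideal. -/
def mkIdeal (s : Set A) (h0 : (0 : A) ∈ s) (hadd : ∀ a ∈ s, ∀ b ∈ s, a + b ∈ s)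
    (hsolid : ∀ a b : A, |a| ≤ |b| → b ∈ s → a ∈ s)
    (hmul : ∀ t ∈ cone A, 0 ≤ t → ∀ a ∈ s, 0 ≤ a → t * a ∈ s) : Ideal A where
  carrier := s
  zero_mem' := h0
  add_mem' := fun {a b} ha hb => hadd a ha b hb
  smul_mem' := by
    intro c a ha
    obtain ⟨t, ht, t', ht', h, h', rfl⟩ := cone_exists_nonneg c
    have key : ∀ t ∈ cone A, 0 ≤ t → t * a ∈ s := fun t ht h =>
      hsolid _ (t * |a|) ((cone_abs_mul_le ht h a).trans (le_abs_self _))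
        (hmul t ht h _ (hsolid _ a (by simp) ha) (abs_nonneg a))
    rw [smul_eq_mul, sub_mul, sub_eq_add_neg]
    exact hadd _ (key t ht h) _ (hsolid _ (t' * a) (by simp) (key t' ht' h'))

theorem mem_of_le (x : MaxLIdeal A) {a b : A} (h0 : 0 ≤ a) (h : a ≤ b) (hb : b ∈ x.ideal) :
    a ∈ x.ideal :=
  x.isLIdeal a b (by rwa [abs_of_nonneg h0, abs_of_nonneg (h0.trans h)]) hb

theorem one_notMem (x : MaxLIdeal A) : (1 : A) ∉ x.ideal := fun h =>
  x.ne_top ((Ideal.eq_top_iff_one _).2 h)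

theorem algebraMap_mem (x : MaxLIdeal A) {r : ℝ} (h : algebraMap ℝ A r ∈ x.ideal) : r = 0 := by
  by_contra hr
  apply x.one_notMem
  have := x.ideal.mul_mem_left (algebraMap ℝ A r⁻¹) h
  rwa [← map_mul, inv_mul_cancel₀ hr, map_one] at this

theorem abs_mem (x : MaxLIdeal A) {a : A} (h : a ∈ x.ideal) : |a| ∈ x.ideal :=
  x.isLIdeal _ a (by simp) h

theorem exists_of_notMem (x : MaxLIdeal A) {b : A} (hT : b ∈ cone A) (h0 : 0 ≤ b)
    (hb : b ∉ x.ideal) : ∃ i ∈ x.ideal, ∃ r : ℝ, 0 ≤ r ∧ (1 : A) ≤ i + r • b := by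
  by_contra hne
  let J : Ideal A := mkIdeal {a | ∃ i ∈ x.ideal, ∃ r : ℝ, 0 ≤ r ∧ |a| ≤ i + r • b}
    ⟨0, x.ideal.zero_mem, 0, le_rfl, by simp⟩
    (by
      rintro a ⟨i, hi, r, hr, h⟩ a' ⟨i', hi', r', hr', h'⟩
      refine ⟨i + i', x.ideal.add_mem hi hi', r + r', add_nonneg hr hr',
        (abs_add_le a a').trans ((add_le_add h h').trans (le_of_eq ?_))⟩
      rw [add_smul]; abel)
    (by
      rintro a a' h ⟨i, hi, r, hr, h'⟩
      exact ⟨i, hi, r, hr, h.trans h'⟩)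
    (by
      rintro t ht ht0 a ⟨i, hi, r, hr, h⟩ ha
      obtain ⟨m, hm, htm⟩ := exists_abs_le t
      refine ⟨t * i, x.ideal.mul_mem_left _ hi, r * m, mul_nonneg hr hm.le, ?_⟩
      refine (cone_abs_mul_le ht ht0 a).trans ((cone_mul_mono ht ht0 h).trans ?_)
      rw [mul_add, mul_smul_comm, mul_smul]
      refine add_le_add le_rfl (smul_mono hr ?_)
      rw [mul_comm, Algebra.smul_def, mul_comm (algebraMap ℝ A m)]
      exact cone_mul_mono hT h0 ((le_abs_self t).trans htm))
  have h1 : J ≠ ⊤ := fun h => by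
    obtain ⟨i, hi, r, hr, h⟩ := (Ideal.eq_top_iff_one J).1 h
    exact hne ⟨i, hi, r, hr, (le_abs_self _).trans h⟩
  have hJ : IsLIdeal J := by
    rintro a a' h ⟨i, hi, r, hr, h'⟩
    exact ⟨i, hi, r, hr, h.trans h'⟩
  have := x.maximal J hJ h1 fun a ha => ⟨|a|, x.abs_mem ha, 0, le_rfl, by simp⟩
  refine hb (this ▸ ?_)
  exact ⟨0, x.ideal.zero_mem, 1, zero_le_one, by rw [abs_of_nonneg h0, one_smul, zero_add]⟩

/-- Maximal `ℓ`-ideals are uniformly closed. -/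
theorem mem_of_approx (x : MaxLIdeal A) {a : A}
    (ha : ∀ ε : ℝ, 0 < ε → ∃ i ∈ x.ideal, |a| ≤ i + algebraMap ℝ A ε) : a ∈ x.ideal := by
  let J : Ideal A := mkIdeal {a | ∀ ε : ℝ, 0 < ε → ∃ i ∈ x.ideal, |a| ≤ i + algebraMap ℝ A ε}
    (fun ε hε => ⟨0, x.ideal.zero_mem, by simpa using algebraMap_nonneg' hε.le⟩)
    (by
      intro a h a' h' ε hε
      obtain ⟨i, hi, h⟩ := h (ε / 2) (by positivity)
      obtain ⟨i', hi', h'⟩ := h' (ε / 2) (by positivity)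
      refine ⟨i + i', x.ideal.add_mem hi hi',
        (abs_add_le a a').trans ((add_le_add h h').trans (le_of_eq ?_))⟩
      conv_rhs => rw [← add_halves ε, map_add]
      abel)
    (by
      intro a a' h h' ε hε
      obtain ⟨i, hi, h'⟩ := h' ε hε
      exact ⟨i, hi, h.trans h'⟩)
    (by
      intro t ht ht0 a h ha ε hε
      obtain ⟨m, hm, htm⟩ := exists_abs_le t
      obtain ⟨i, hi, h⟩ := h (ε / m) (by positivity)
      refine ⟨t * i, x.ideal.mul_mem_left _ hi, ?_⟩
      refine (cone_abs_mul_le ht ht0 a).trans ((cone_mul_mono ht ht0 h).trans ?_)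
      rw [mul_add]
      refine add_le_add le_rfl ?_
      have h1 := smul_mono (show 0 ≤ ε / m by positivity) ((le_abs_self t).trans htm)
      rw [Algebra.smul_def, Algebra.smul_def, ← map_mul, div_mul_cancel₀ _ hm.ne'] at h1
      rwa [mul_comm])
  have h1 : J ≠ ⊤ := fun h => by
    obtain ⟨i, hi, h⟩ := (Ideal.eq_top_iff_one J).1 h (1 / 2) (by norm_num)
    have h2 : algebraMap ℝ A (1 / 2) ≤ i := by
      have h3 := (le_abs_self _).trans h
      rw [← map_one (algebraMap ℝ A), ← sub_le_iff_le_add, ← map_sub] at h3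
      norm_num at h3 ⊢
      exact h3
    have := x.algebraMap_mem (x.mem_of_le (algebraMap_nonneg' (by norm_num)) h2 hi)
    norm_num at this
  have hJ : IsLIdeal J := by
    intro a a' h h' ε hε
    obtain ⟨i, hi, h'⟩ := h' ε hε
    exact ⟨i, hi, h.trans h'⟩
  rw [← x.maximal J hJ h1 fun a ha ε hε => ⟨|a|, x.abs_mem ha, by
    simpa using algebraMap_nonneg' hε.le⟩]
  exact ha

theorem posPart_mem_or_negPart_mem (x : MaxLIdeal A) {a : A} (hT : a ∈ cone A) :
    a⁺ ∈ x.ideal ∨ a⁻ ∈ x.ideal := by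
  by_contra! h
  obtain ⟨i, hi, r, hr, h1⟩ := x.exists_of_notMem (cone_posPart hT) (posPart_nonneg a) h.1
  apply h.2
  obtain ⟨m, hm, hle⟩ := exists_abs_le a
  have hnm : a⁻ ≤ algebraMap ℝ A m :=
    (sup_le (neg_le_abs a) (abs_nonneg a)).trans hle
  set M := max (max m r) 1
  have hM : 0 ≤ M := zero_le_one.trans (le_max_right _ _)
  have hrM : r ≤ M := (le_max_right _ _).trans (le_max_left _ _)
  have hmM : m ≤ M := (le_max_left _ _).trans (le_max_left _ _)
  have h2 : a⁻ ≤ M • |i| + (M * M) • a⁺ := by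
    have h3 : algebraMap ℝ A M ≤ M • |i| + (M * M) • a⁺ := by
      have h4 : (1 : A) ≤ |i| + M • a⁺ := by
        refine h1.trans (add_le_add (le_abs_self i) ?_)
        have := IsWeakBal.smul_nonneg' (M - r) a⁺ (by linarith) (posPart_nonneg a)
        rw [sub_smul] at this
        exact sub_nonneg.1 this
      have h5 := smul_mono hM h4
      rwa [smul_add, ← Algebra.algebraMap_eq_smul_one, smul_smul] at h5
    exact (hnm.trans (algebraMap_mono hmM)).trans h3
  have hMM : (1 : ℝ) ≤ M * M := by
    have : (1 : ℝ) ≤ M := le_max_right _ _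
    nlinarith
  have hMM0 : (0 : ℝ) < M * M := by linarith
  have h6 : (M * M)⁻¹ • a⁻ - (M * M)⁻¹ • (M • |i|) ≤ a⁺ ⊓ a⁻ := by
    refine le_inf ?_ ?_
    · have := smul_mono (inv_nonneg.2 hMM0.le) h2
      rw [smul_add, smul_smul _ (M * M), inv_mul_cancel₀ hMM0.ne', one_smul] at this
      rwa [sub_le_iff_le_add, add_comm]
    · have h7 : (M * M)⁻¹ • a⁻ ≤ a⁻ := by
        have := IsWeakBal.smul_nonneg' (1 - (M * M)⁻¹) a⁻
          (sub_nonneg.2 (inv_le_one_of_one_le₀ hMM)) (negPart_nonneg a)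
        rw [sub_smul, one_smul] at this
        exact sub_nonneg.1 this
      have h8 : 0 ≤ (M * M)⁻¹ • (M • |i|) :=
        IsWeakBal.smul_nonneg' _ _ (inv_nonneg.2 hMM0.le)
          (IsWeakBal.smul_nonneg' _ _ hM (abs_nonneg i))
      exact (sub_le_self _ h8).trans h7
  rw [posPart_inf_negPart_eq_zero, sub_nonpos] at h6
  have h9 := smul_mono hMM0.le h6
  rw [smul_smul, smul_smul, mul_inv_cancel₀ hMM0.ne', one_smul, one_smul] at h9
  refine x.mem_of_le (negPart_nonneg a) h9 ?_
  rw [Algebra.smul_def]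
  exact x.ideal.mul_mem_left _ (x.abs_mem hi)

theorem exists_sub_mem_cone (x : MaxLIdeal A) {a : A} (hT : a ∈ cone A) :
    ∃ r : ℝ, a - algebraMap ℝ A r ∈ x.ideal := by
  have hsub : ∀ s : ℝ, a - algebraMap ℝ A s ∈ cone A := fun s => by
    have := cone_add hT (-s)
    rwa [map_neg, ← sub_eq_add_neg] at this
  let T : Set ℝ := {s | (a - algebraMap ℝ A s)⁺ ∈ x.ideal}
  obtain ⟨n, hn, hle⟩ := exists_abs_le a
  have hne : T.Nonempty := ⟨n, by
    have : (a - algebraMap ℝ A n)⁺ = 0 :=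
      posPart_eq_zero.2 (sub_nonpos.2 ((le_abs_self a).trans hle))
    simp only [T, Set.mem_ofPred_eq, this]; exact x.ideal.zero_mem⟩
  have hbdd : BddBelow T := ⟨-n, fun s hs => by
    by_contra! hlt
    have h3 : algebraMap ℝ A (-n - s) ≤ (a - algebraMap ℝ A s)⁺ := by
      refine le_trans ?_ (le_posPart _)
      rw [map_sub, map_neg]
      exact sub_le_sub_right (neg_le.1 ((neg_le_abs a).trans hle)) _
    have h4 := x.algebraMap_mem (x.mem_of_le (algebraMap_nonneg' (by linarith)) h3 hs)
    linarith⟩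
  have hup : ∀ s t, s ≤ t → s ∈ T → t ∈ T := fun s t hst hs =>
    x.mem_of_le (posPart_nonneg _) (posPart_mono (sub_le_sub_left (algebraMap_mono hst) a)) hs
  refine ⟨sInf T, x.mem_of_approx fun ε hε => ?_⟩
  set r := sInf T
  have hA : (a - algebraMap ℝ A (r + ε))⁺ ∈ x.ideal := by
    obtain ⟨s, hs, hlt⟩ := exists_lt_of_csInf_lt hne (show sInf T < r + ε by linarith)
    exact hup s _ hlt.le hs
  have hB : (a - algebraMap ℝ A (r - ε))⁻ ∈ x.ideal := by
    refine (x.posPart_mem_or_negPart_mem (hsub _)).resolve_left fun hc => ?_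
    have := csInf_le hbdd (show r - ε ∈ T from hc)
    linarith
  refine ⟨_, x.ideal.add_mem hA hB, sup_le ?_ ?_⟩
  · have e1 : a - algebraMap ℝ A r = (a - algebraMap ℝ A (r + ε)) + 0 + algebraMap ℝ A ε := by
      rw [map_add]; ring
    rw [e1]
    exact add_le_add (add_le_add (le_posPart _) (negPart_nonneg _)) le_rfl
  · have e1 : -(a - algebraMap ℝ A r) = 0 + -(a - algebraMap ℝ A (r - ε)) + algebraMap ℝ A ε := by
      rw [map_sub]; ring
    rw [e1]
    exact add_le_add (add_le_add (posPart_nonneg _) (neg_le_negPart _)) le_rfl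

/-- The quotient by a maximal `ℓ`-ideal is the real field. -/
theorem exists_sub_mem (x : MaxLIdeal A) (a : A) : ∃ r : ℝ, a - algebraMap ℝ A r ∈ x.ideal := by
  obtain ⟨c, hc, d, hd, rfl⟩ := cone_exists a
  obtain ⟨r, hr⟩ := x.exists_sub_mem_cone hc
  obtain ⟨s, hs⟩ := x.exists_sub_mem_cone hd
  refine ⟨r - s, ?_⟩
  have := x.ideal.sub_mem hr hs
  rw [map_sub]; convert this using 1; ring

/-- The value at `x` of the element `a`: the real number `r` with `a - r ∈ x`. -/
noncomputable def val (x : MaxLIdeal A) (a : A) : ℝ := (x.exists_sub_mem a).choose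

theorem sub_val_mem (x : MaxLIdeal A) (a : A) : a - algebraMap ℝ A (x.val a) ∈ x.ideal :=
  (x.exists_sub_mem a).choose_spec

theorem val_eq (x : MaxLIdeal A) {a : A} {r : ℝ} (h : a - algebraMap ℝ A r ∈ x.ideal) :
    x.val a = r := by
  have := x.ideal.sub_mem h (x.sub_val_mem a)
  rw [sub_sub_sub_cancel_left, ← map_sub] at this
  linarith [x.algebraMap_mem this]

theorem mem_iff (x : MaxLIdeal A) (a : A) : a ∈ x.ideal ↔ x.val a = 0 := by
  constructor
  · intro h; exact x.val_eq (by simpa using h)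
  · intro h; simpa [h] using x.sub_val_mem a

theorem val_algebraMap (x : MaxLIdeal A) (r : ℝ) : x.val (algebraMap ℝ A r) = r :=
  x.val_eq (by simp)

theorem val_add (x : MaxLIdeal A) (a b : A) : x.val (a + b) = x.val a + x.val b :=
  x.val_eq (by
    have := x.ideal.add_mem (x.sub_val_mem a) (x.sub_val_mem b)
    rw [map_add]; convert this using 1; ring)

theorem val_mul (x : MaxLIdeal A) (a b : A) : x.val (a * b) = x.val a * x.val b :=
  x.val_eq (by
    have := x.ideal.add_mem (x.ideal.mul_mem_right b (x.sub_val_mem a))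
      (x.ideal.mul_mem_left (algebraMap ℝ A (x.val a)) (x.sub_val_mem b))
    rw [map_mul]; convert this using 1; ring)

theorem val_one (x : MaxLIdeal A) : x.val (1 : A) = 1 := by
  simpa using x.val_algebraMap 1

theorem val_zero (x : MaxLIdeal A) : x.val (0 : A) = 0 := by
  simpa using x.val_algebraMap 0

theorem val_neg (x : MaxLIdeal A) (a : A) : x.val (-a) = -x.val a := by
  have := x.val_add a (-a)
  rw [add_neg_cancel, val_zero] at this; linarith

theorem val_sub (x : MaxLIdeal A) (a b : A) : x.val (a - b) = x.val a - x.val b := by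
  rw [sub_eq_add_neg, val_add, val_neg, sub_eq_add_neg]

theorem val_nonneg (x : MaxLIdeal A) {a : A} (h : 0 ≤ a) : 0 ≤ x.val a := by
  by_contra! hlt
  have h1 : algebraMap ℝ A (-x.val a) ≤ a - algebraMap ℝ A (x.val a) := by
    rw [map_neg, sub_eq_add_neg]; simpa using h
  have := x.algebraMap_mem (x.mem_of_le (algebraMap_nonneg' (by linarith)) h1 (x.sub_val_mem a))
  linarith

theorem val_mono (x : MaxLIdeal A) {a b : A} (h : a ≤ b) : x.val a ≤ x.val b := by
  have := x.val_nonneg (sub_nonneg.2 h)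
  rw [val_sub] at this; linarith

theorem val_posPart (x : MaxLIdeal A) (a : A) : x.val a⁺ = max (x.val a) 0 := by
  have h1 : x.val a = x.val a⁺ - x.val a⁻ := by rw [← val_sub, posPart_sub_negPart]
  have h3 := x.val_nonneg (posPart_nonneg a)
  have h4 := x.val_nonneg (negPart_nonneg a)
  have h2 : min (x.val a⁺) (x.val a⁻) = 0 := by
    set i := |a⁺ - algebraMap ℝ A (x.val a⁺)| + |a⁻ - algebraMap ℝ A (x.val a⁻)| with hi
    have hmem : i ∈ x.ideal :=
      x.ideal.add_mem (x.abs_mem (x.sub_val_mem _)) (x.abs_mem (x.sub_val_mem _))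
    have key : ∀ b : A, |b - algebraMap ℝ A (x.val b)| ≤ i → min (x.val a⁺) (x.val a⁻) ≤ x.val b →
        algebraMap ℝ A (min (x.val a⁺) (x.val a⁻)) - i ≤ b := fun b hb hle => by
      rw [sub_le_iff_le_add]
      refine (algebraMap_mono hle).trans ?_
      have := (neg_le_abs _).trans hb
      rwa [neg_sub, sub_le_iff_le_add, add_comm] at this
    have h5 := le_inf (key a⁺ (le_add_of_nonneg_right (abs_nonneg _)) (min_le_left _ _))
      (key a⁻ (le_add_of_nonneg_left (abs_nonneg _)) (min_le_right _ _))
    rw [posPart_inf_negPart_eq_zero, sub_nonpos] at h5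
    exact x.algebraMap_mem (x.mem_of_le (algebraMap_nonneg' (le_min h3 h4)) h5 hmem)
  rcases min_choice (x.val a⁺) (x.val a⁻) with h | h
  · rw [h2] at h
    rw [← h, max_eq_right (by linarith)]
  · rw [h2] at h
    rw [h1, ← h, sub_zero, max_eq_left h3]

theorem val_sup (x : MaxLIdeal A) (a b : A) : x.val (a ⊔ b) = x.val a ⊔ x.val b := by
  have : a ⊔ b = (a - b)⁺ + b := by rw [posPart_def, sup_add]; simp
  rw [this, val_add, val_posPart, val_sub, ← max_add_add_right]; simp

theorem val_inf (x : MaxLIdeal A) (a b : A) : x.val (a ⊓ b) = x.val a ⊓ x.val b := by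
  have h := congrArg x.val (inf_add_sup a b)
  have h' := inf_add_sup (x.val a) (x.val b)
  rw [val_add, val_add, val_sup] at h
  linarith

theorem val_abs (x : MaxLIdeal A) (a : A) : x.val |a| = |x.val a| := by
  rw [abs, abs, val_sup, val_neg]

theorem val_ext {x y : MaxLIdeal A} (h : ∀ a, x.val a = y.val a) : x = y := by
  ext a; rw [mem_iff, mem_iff, h]

/-- Evaluation at `x` as a unital `ℓ`-algebra homomorphism. -/
noncomputable def valHom (x : MaxLIdeal A) : BalHom A ℝ where
  toFun := x.val
  map_one' := x.val_one
  map_mul' := x.val_mul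
  map_zero' := x.val_zero
  map_add' := x.val_add
  commutes' := x.val_algebraMap
  map_sup' := x.val_sup
  map_inf' := x.val_inf

/-- The kernel of a unital `ℓ`-algebra homomorphism to the reals is a maximal `ℓ`-ideal. -/
def ofHom (f : BalHom A ℝ) : MaxLIdeal A where
  ideal := RingHom.ker f.toAlgHom
  isLIdeal a b h hb := by
    rw [RingHom.mem_ker] at hb ⊢
    have := f.monotone h
    rw [f.map_abs, f.map_abs, hb, abs_zero] at this
    exact abs_eq_zero.1 (le_antisymm this (abs_nonneg _))
  ne_top h := by
    have := (Ideal.eq_top_iff_one _).1 h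
    rw [RingHom.mem_ker, map_one] at this
    exact one_ne_zero this
  maximal J _ hJ h := by
    refine le_antisymm (fun a ha => ?_) h
    rw [RingHom.mem_ker]
    by_contra hne
    apply hJ
    rw [Ideal.eq_top_iff_one]
    have h1 : a - algebraMap ℝ A (f.toAlgHom a) ∈ J := h (by
      rw [RingHom.mem_ker, map_sub, AlgHom.commutes]; simp)
    have h2 := J.mul_mem_left (algebraMap ℝ A (f.toAlgHom a)⁻¹) (J.sub_mem ha h1)
    rwa [sub_sub_cancel, ← map_mul, inv_mul_cancel₀ hne, map_one] at h2

theorem val_ofHom (f : BalHom A ℝ) (a : A) : (ofHom f).val a = f.toAlgHom a := by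
  apply val_eq
  change _ ∈ RingHom.ker f.toAlgHom
  rw [RingHom.mem_ker, map_sub, AlgHom.commutes]; simp

/-- `Z I` is the set of maximal `ℓ`-ideals that contain the ideal `I`. -/
def Z (I : Ideal A) : Set (MaxLIdeal A) := {x | I ≤ x.ideal}

theorem mem_Z {I : Ideal A} {x : MaxLIdeal A} : x ∈ Z I ↔ I ≤ x.ideal := Iff.rfl

/-- The topology on the set of maximal `ℓ`-ideals whose closed sets are exactly the sets `Z I`,
where `I` is an `ℓ`-ideal. -/
instance : TopologicalSpace (MaxLIdeal A) :=
  TopologicalSpace.ofClosed {s | ∃ I : Ideal A, IsLIdeal I ∧ s = Z I}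
    ⟨⊤, fun _ _ _ _ => trivial, by
      ext x; simp only [Z, Set.mem_empty_iff_false, Set.mem_ofPred_eq, false_iff, top_le_iff]
      exact x.ne_top⟩
    (by
      intro T hT
      refine ⟨sInf {J | IsLIdeal J ∧ ∀ I, IsLIdeal I → Z I ∈ T → I ≤ J}, ?_, ?_⟩
      · intro a b h hb
        rw [Submodule.mem_sInf] at hb ⊢
        exact fun J hJ => hJ.1 a b h (hb J hJ)
      · ext x
        constructor
        · intro hx
          exact mem_Z.2 (sInf_le ⟨x.isLIdeal, fun I hI hIT => mem_Z.1 (hx _ hIT)⟩)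
        · intro hx s hs
          obtain ⟨I, hI, rfl⟩ := hT hs
          exact mem_Z.2 (le_trans (le_sInf fun J hJ => hJ.2 I hI hs) (mem_Z.1 hx)))
    (by
      rintro _ ⟨I, hI, rfl⟩ _ ⟨J, hJ, rfl⟩
      refine ⟨I ⊓ J, fun a b h hb => ⟨hI a b h hb.1, hJ a b h hb.2⟩, ?_⟩
      ext x
      constructor
      · rintro (h | h)
        · exact mem_Z.2 (inf_le_left.trans (mem_Z.1 h))
        · exact mem_Z.2 (inf_le_right.trans (mem_Z.1 h))
      · intro h
        by_contra hne
        simp only [Set.mem_union, not_or, mem_Z, SetLike.not_le_iff_exists] at hne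
        obtain ⟨⟨a, ha, ha'⟩, b, hb, hb'⟩ := hne
        have := mem_Z.1 h ⟨I.mul_mem_right b ha, J.mul_mem_left a hb⟩
        rw [mem_iff, val_mul, mul_eq_zero, ← mem_iff, ← mem_iff] at this
        exact this.elim ha' hb')

theorem isClosed_iff (s : Set (MaxLIdeal A)) : IsClosed s ↔ ∃ I : Ideal A, IsLIdeal I ∧ s = Z I := by
  rw [← isOpen_compl_iff]
  change sᶜᶜ ∈ {s | ∃ I : Ideal A, IsLIdeal I ∧ s = Z I} ↔ _
  rw [compl_compl]; rfl

theorem isClosed_le (a : A) (s : ℝ) : IsClosed {x : MaxLIdeal A | x.val a ≤ s} := by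
  rw [isClosed_iff]
  have h0 : ∀ x : MaxLIdeal A, x.val a ≤ s ↔ (a - algebraMap ℝ A s)⁺ ∈ x.ideal := fun x => by
    rw [mem_iff, val_posPart, val_sub, val_algebraMap]; simp
  refine ⟨sInf {J | ∃ x : MaxLIdeal A, x.val a ≤ s ∧ J = x.ideal}, ?_, ?_⟩
  · intro b c h hc
    rw [Submodule.mem_sInf] at hc ⊢
    rintro _ ⟨x, hx, rfl⟩
    exact x.isLIdeal b c h (hc _ ⟨x, hx, rfl⟩)
  · ext x
    rw [Set.mem_ofPred_eq, mem_Z]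
    constructor
    · intro hx
      exact sInf_le ⟨x, hx, rfl⟩
    · intro hx
      rw [h0]
      refine hx (Submodule.mem_sInf.2 ?_)
      rintro _ ⟨y, hy, rfl⟩
      exact (h0 y).1 hy

theorem continuous_val (a : A) : Continuous fun x : MaxLIdeal A => x.val a := by
  rw [OrderTopology.topology_eq_generate_intervals (α := ℝ), continuous_generateFrom_iff]
  rintro _ ⟨s, rfl | rfl⟩
  · have := (isClosed_le a s).isOpen_compl
    convert this using 1
    ext x; simp
  · have := (isClosed_le (-a) (-s)).isOpen_compl
    convert this using 1
    ext x; simp [val_neg]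

/-- All evaluations together. -/
noncomputable def evals (x : MaxLIdeal A) : A → ℝ := fun a => x.val a

theorem isInducing_evals : Topology.IsInducing (evals : MaxLIdeal A → A → ℝ) := by
  refine ⟨le_antisymm ?_ ?_⟩
  · exact continuous_iff_le_induced.1 (continuous_pi continuous_val)
  · intro s hs
    rw [← isClosed_compl_iff, isClosed_iff] at hs
    obtain ⟨I, hI, hs⟩ := hs
    have : s = evals ⁻¹' (⋂ a ∈ I, {f : A → ℝ | f a = 0})ᶜ := by
      rw [← compl_compl s, hs]
      ext x
      simp only [Z, Set.preimage_compl, Set.mem_compl_iff, Set.mem_ofPred_eq, Set.mem_preimage,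
        Set.mem_iInter, evals, ← mem_iff]
      rfl
    rw [this]
    refine ⟨_, IsClosed.isOpen_compl (self := ?_), rfl⟩
    exact isClosed_biInter fun a _ => isClosed_eq (continuous_apply a) continuous_const

instance : CompactSpace (MaxLIdeal A) := by
  rw [← isCompact_univ_iff, isInducing_evals.isCompact_iff, Set.image_univ]
  choose n hn0 hn using fun a : A => exists_abs_le a
  have hK : IsCompact (Set.univ.pi fun a : A => Set.Icc (-n a) (n a)) :=
    isCompact_univ_pi fun a => isCompact_Icc
  have hC : IsClosed {f : A → ℝ | (∀ r, f (algebraMap ℝ A r) = r) ∧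
      (∀ a b, f (a + b) = f a + f b) ∧ (∀ a b, f (a * b) = f a * f b) ∧
      (∀ a b, f (a ⊔ b) = f a ⊔ f b) ∧ ∀ a b, f (a ⊓ b) = f a ⊓ f b} := by
    simp only [Set.ofPred_and, Set.ofPred_forall]
    refine IsClosed.inter ?_ (IsClosed.inter ?_ (IsClosed.inter ?_ (IsClosed.inter ?_ ?_)))
    · exact isClosed_iInter fun r => isClosed_eq (by fun_prop) (by fun_prop)
    all_goals
      exact isClosed_iInter fun a => isClosed_iInter fun b => isClosed_eq (by fun_prop) (by fun_prop)
  convert hK.inter_right hC using 1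
  ext f
  constructor
  · rintro ⟨x, rfl⟩
    refine ⟨fun a _ => ?_, x.val_algebraMap, x.val_add, x.val_mul, x.val_sup, x.val_inf⟩
    have := x.val_mono (hn a)
    rw [val_abs, val_algebraMap] at this
    exact abs_le.1 this
  · rintro ⟨-, h1, h2, h3, h4, h5⟩
    refine ⟨ofHom ⟨⟨⟨⟨⟨f, ?_⟩, h3⟩, ?_, h2⟩, h1⟩, h4, h5⟩, ?_⟩
    · simpa using h1 1
    · simpa using h1 0
    · ext a; exact val_ofHom _ a

end

section

variable {A : Type u} {B : Type v} {C : Type w} [CommRing A] [Lattice A] [Algebra ℝ A] [IsWeakBal A]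
  [CommRing B] [Lattice B] [Algebra ℝ B] [IsWeakBal B] [CommRing C] [Lattice C] [Algebra ℝ C] [IsWeakBal C]

/-- The map `α⁻¹` on maximal `ℓ`-ideals. -/
def comap (α : BalHom A B) (y : MaxLIdeal B) : MaxLIdeal A where
  ideal := y.ideal.comap α.toAlgHom
  isLIdeal a b h hb := by
    refine y.isLIdeal _ _ ?_ hb
    rw [← α.map_abs, ← α.map_abs]
    exact α.monotone h
  ne_top h := y.one_notMem (by
    have := (Ideal.eq_top_iff_one _).1 h
    rwa [Ideal.mem_comap, map_one] at this)
  maximal := by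
    have : y.ideal.comap α.toAlgHom = (ofHom (y.valHom.comp α)).ideal := by
      ext a; rw [Ideal.mem_comap, mem_iff]; rfl
    rw [this]
    exact (ofHom (y.valHom.comp α)).maximal

theorem val_comap (α : BalHom A B) (y : MaxLIdeal B) (a : A) :
    (comap α y).val a = y.val (α.toAlgHom a) := by
  apply val_eq
  change α.toAlgHom _ ∈ y.ideal
  rw [map_sub, AlgHom.commutes]
  exact y.sub_val_mem _

theorem continuous_comap (α : BalHom A B) : Continuous (comap α) := by
  rw [isInducing_evals.continuous_iff]
  refine continuous_pi fun a => ?_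
  change Continuous fun y => (comap α y).val a
  simp only [val_comap]
  exact continuous_val _

end

end MaxLIdeal

/-! ### Nachbin spaces -/

/-- Nachbin spaces: compact spaces with a partial order that is closed in the product. -/
structure Nach : Type (u + 1) where
  carrier : Type u
  [topologicalSpace : TopologicalSpace carrier]
  [partialOrder : PartialOrder carrier]
  [compactSpace : CompactSpace carrier]
  [orderClosedTopology : OrderClosedTopology carrier]

attribute [instance] Nach.topologicalSpace Nach.partialOrder Nach.compactSpace
  Nach.orderClosedTopology

/-- Morphisms of Nachbin spaces: continuous order-preserving maps. -/
@[ext]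
structure Nach.Hom (X Y : Nach.{u}) where
  toFun : X.carrier → Y.carrier
  continuous : Continuous toFun
  monotone : Monotone toFun

instance : Category Nach.{u} where
  Hom := Nach.Hom
  id X := ⟨fun x => x, continuous_id, monotone_id⟩
  comp f g := ⟨fun x => g.toFun (f.toFun x), g.continuous.comp f.continuous,
    g.monotone.comp f.monotone⟩

/-! ### Proximities -/

section Proximity

variable {A : Type u} [CommRing A] [Lattice A] [Algebra ℝ A]

/-- Proximities on an `ℓ`-algebra. -/
structure IsProximity (prec : A → A → Prop) : Prop where
  le : ∀ a b, prec a b → a ≤ b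
  mono : ∀ a b c d, a ≤ b → prec b c → c ≤ d → prec a d
  inf : ∀ a b c, prec a b → prec a c → prec a (b ⊓ c)
  sup : ∀ a b c, prec a c → prec b c → prec (a ⊔ b) c
  interpolate : ∀ a b, prec a b → ∃ c, prec a c ∧ prec c b
  add : ∀ a b c d, prec a b → prec c d → prec (a + c) (b + d)
  mul : ∀ a b c d, 0 ≤ a → 0 ≤ b → 0 ≤ c → 0 ≤ d → prec a b → prec c d → prec (a * c) (b * d)
  real : ∀ r : ℝ, prec (algebraMap ℝ A r) (algebraMap ℝ A r)
  smul : ∀ a b, ∀ r : ℝ, 0 ≤ r → prec a b → prec (r • a) (r • b)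

/-- Reflexive proximities. -/
structure IsReflexiveProximity (prec : A → A → Prop) : Prop extends IsProximity prec where
  exists_reflexive : ∀ a b, prec a b → ∃ c, prec c c ∧ prec a c ∧ prec c b

/-- The norm of a bounded archimedean `ℓ`-algebra. -/
noncomputable def balNorm (a : A) : ℝ := sInf {r : ℝ | |a| ≤ algebraMap ℝ A r}

/-- Nachbin proximities: reflexive proximities for which the differences `c - d` of reflexive
elements, which form the `ℓ`-subalgebra generated by the reflexive elements, are uniformly dense. -/
structure IsNachbinProximity (prec : A → A → Prop) : Prop extends IsReflexiveProximity prec where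
  dense : ∀ a : A, ∀ ε : ℝ, 0 < ε → ∃ c d, prec c c ∧ prec d d ∧ balNorm (a - (c - d)) < ε

section

theorem balNorm_le [IsWeakBal A] {a : A} {r : ℝ} (hr : 0 ≤ r) (h : |a| ≤ algebraMap ℝ A r) : balNorm a ≤ r := by
  by_cases hb : BddBelow {r : ℝ | |a| ≤ algebraMap ℝ A r}
  · exact csInf_le hb h
  · rw [balNorm, Real.sInf_of_not_bddBelow hb]; exact hr

theorem abs_le_of_balNorm_lt [IsWeakBal A] {a : A} {r : ℝ} (h : balNorm a < r) : |a| ≤ algebraMap ℝ A r := by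
  have hne : {r : ℝ | |a| ≤ algebraMap ℝ A r}.Nonempty := by
    obtain ⟨n, -, hn⟩ := exists_abs_le a
    exact ⟨n, hn⟩
  obtain ⟨s, hs, hlt⟩ := exists_lt_of_csInf_lt hne h
  exact le_trans hs (algebraMap_mono hlt.le)

/-- A set of elements closed under the operations of an `ℓ`-semialgebra gives a reflexive
proximity, for which it is the set of reflexive elements. -/
theorem isReflexiveProximity_of_set [IsBal A] (S : Set A) (hr : ∀ r : ℝ, algebraMap ℝ A r ∈ S)
    (hsup : ∀ a ∈ S, ∀ b ∈ S, a ⊔ b ∈ S) (hinf : ∀ a ∈ S, ∀ b ∈ S, a ⊓ b ∈ S)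
    (hadd : ∀ a ∈ S, ∀ b ∈ S, a + b ∈ S)
    (hmul : ∀ a ∈ S, ∀ b ∈ S, 0 ≤ a → 0 ≤ b → a * b ∈ S)
    (hsmul : ∀ r : ℝ, 0 ≤ r → ∀ a ∈ S, r • a ∈ S) :
    IsReflexiveProximity fun a b : A => ∃ s ∈ S, a ≤ s ∧ s ≤ b where
  le := fun _ _ ⟨_, _, h, h'⟩ => h.trans h'
  mono := fun _ _ _ _ h ⟨s, hs, h1, h2⟩ h' => ⟨s, hs, h.trans h1, h2.trans h'⟩
  inf := fun _ _ _ ⟨s, hs, h1, h2⟩ ⟨t, ht, h3, h4⟩ =>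
    ⟨s ⊓ t, hinf s hs t ht, le_inf h1 h3, inf_le_inf h2 h4⟩
  sup := fun _ _ _ ⟨s, hs, h1, h2⟩ ⟨t, ht, h3, h4⟩ =>
    ⟨s ⊔ t, hsup s hs t ht, sup_le_sup h1 h3, sup_le h2 h4⟩
  interpolate := fun _ _ ⟨s, hs, h1, h2⟩ => ⟨s, ⟨s, hs, h1, le_rfl⟩, s, hs, le_rfl, h2⟩
  add := fun _ _ _ _ ⟨s, hs, h1, h2⟩ ⟨t, ht, h3, h4⟩ =>
    ⟨s + t, hadd s hs t ht, add_le_add h1 h3, add_le_add h2 h4⟩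
  mul := fun _ _ _ _ ha _ hc _ ⟨s, hs, h1, h2⟩ ⟨t, ht, h3, h4⟩ =>
    ⟨s * t, hmul s hs t ht (ha.trans h1) (hc.trans h3),
      mul_le_mul h1 h3 hc (ha.trans h1),
      mul_le_mul h2 h4 (hc.trans h3) ((ha.trans h1).trans h2)⟩
  real := fun r => ⟨_, hr r, le_rfl, le_rfl⟩
  smul := fun _ _ r h ⟨s, hs, h1, h2⟩ => ⟨r • s, hsmul r h s hs, smul_mono h h1, smul_mono h h2⟩
  exists_reflexive := fun _ _ ⟨s, hs, h1, h2⟩ =>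
    ⟨s, ⟨s, hs, le_rfl, le_rfl⟩, ⟨s, hs, h1, le_rfl⟩, s, hs, le_rfl, h2⟩

end

/-! ### The order on the space of maximal `ℓ`-ideals -/

/-- For a maximal `ℓ`-ideal `y`, the set of elements whose absolute value is bounded by a
nonnegative reflexive element of `y`. -/
def below (prec : A → A → Prop) (y : MaxLIdeal A) : Set A :=
  {a | ∃ c ∈ y.ideal, prec c c ∧ 0 ≤ c ∧ |a| ≤ c}

/-- The properties of the reflexive elements that make the space of maximal `ℓ`-ideals a
Nachbin space. -/
structure IsOrdering (prec : A → A → Prop) : Prop where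
  posPart : ∀ c, ∀ r : ℝ, prec c c →
    prec (c - algebraMap ℝ A r)⁺ (c - algebraMap ℝ A r)⁺
  dense : ∀ a : A, ∀ ε : ℝ, 0 < ε → ∃ c d, prec c c ∧ prec d d ∧ balNorm (a - (c - d)) < ε

variable [IsWeakBal A]

theorem IsNachbinProximity.isOrdering {prec : A → A → Prop} (h : IsNachbinProximity prec) :
    IsOrdering prec where
  posPart c r hc := by
    have hs : prec (c - algebraMap ℝ A r) (c - algebraMap ℝ A r) := by
      have := h.add _ _ _ _ hc (h.real (-r))
      rwa [map_neg, ← sub_eq_add_neg] at this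
    have hz : prec 0 0 := by simpa using h.real 0
    rw [posPart_def]
    exact h.sup _ _ _ (h.mono _ _ _ _ le_rfl hs le_sup_left)
      (h.mono _ _ _ _ le_rfl hz le_sup_right)
  dense := h.dense

theorem below_subset_iff {prec : A → A → Prop} (hp : IsOrdering prec) (x y : MaxLIdeal A) :
    below prec y ⊆ x.ideal ↔ ∀ c, prec c c → x.val c ≤ y.val c := by
  constructor
  · intro h c hc
    have h2 : (c - algebraMap ℝ A (y.val c))⁺ ∈ y.ideal := by
      rw [y.mem_iff, y.val_posPart, y.val_sub, y.val_algebraMap]; simp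
    have h3 := h ⟨_, h2, hp.posPart c _ hc, posPart_nonneg _,
      (abs_of_nonneg (posPart_nonneg _)).le⟩
    rw [SetLike.mem_coe, x.mem_iff, x.val_posPart, x.val_sub, x.val_algebraMap] at h3
    simpa using h3
  · rintro h a ⟨c, hcy, hc, h0, ha⟩
    have h1 := h c hc
    rw [(y.mem_iff c).1 hcy] at h1
    rw [SetLike.mem_coe, x.mem_iff]
    have h2 := x.val_mono ha
    rw [x.val_abs] at h2
    exact abs_eq_zero.1 (le_antisymm (h2.trans h1) (abs_nonneg _))

/-- The order on the space of maximal `ℓ`-ideals: `x ≤ y` if and only if `below prec y ⊆ x`. -/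
@[reducible]
def specOrder {prec : A → A → Prop} (hp : IsOrdering prec) : PartialOrder (MaxLIdeal A) where
  le x y := below prec y ⊆ x.ideal
  le_refl x := (below_subset_iff hp x x).2 fun _ _ => le_rfl
  le_trans x y z h h' := (below_subset_iff hp x z).2 fun c hc =>
    ((below_subset_iff hp x y).1 h c hc).trans ((below_subset_iff hp y z).1 h' c hc)
  le_antisymm x y h h' := by
    have e : ∀ c, prec c c → x.val c = y.val c := fun c hc =>
      le_antisymm ((below_subset_iff hp x y).1 h c hc) ((below_subset_iff hp y x).1 h' c hc)
    refine MaxLIdeal.val_ext fun a => eq_of_forall_dist_le fun ε hε => ?_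
    obtain ⟨c, d, hc, hd, hlt⟩ := hp.dense a (ε / 2) (by positivity)
    have hle := abs_le_of_balNorm_lt hlt
    have hx := x.val_mono hle
    have hy := y.val_mono hle
    rw [x.val_abs, x.val_sub, x.val_sub, x.val_algebraMap] at hx
    rw [y.val_abs, y.val_sub, y.val_sub, y.val_algebraMap, ← e c hc, ← e d hd] at hy
    rw [Real.dist_eq]
    rw [abs_le] at hx hy ⊢
    constructor <;> linarith [hx.1, hx.2, hy.1, hy.2]

/-- The Nachbin space of maximal `ℓ`-ideals. -/
def spec {prec : A → A → Prop} (hp : IsOrdering prec) : Nach.{u} :=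
  letI := specOrder hp
  { carrier := MaxLIdeal A
    orderClosedTopology := ⟨by
      have : {p : MaxLIdeal A × MaxLIdeal A | p.1 ≤ p.2} =
          {p | ∀ c, prec c c → p.1.val c ≤ p.2.val c} := by
        ext p; exact below_subset_iff hp p.1 p.2
      rw [this]
      simp only [Set.ofPred_forall]
      exact isClosed_iInter fun c => isClosed_iInter fun _ =>
        isClosed_le ((MaxLIdeal.continuous_val c).comp continuous_fst)
          ((MaxLIdeal.continuous_val c).comp continuous_snd)⟩ }

/-- The map `α⁻¹` between the spaces of maximal `ℓ`-ideals. -/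
def specMap {B : Type u} [CommRing B] [Lattice B] [Algebra ℝ B] [IsWeakBal B]
    {prec : A → A → Prop} {prec' : B → B → Prop} (hp : IsOrdering prec) (hp' : IsOrdering prec')
    (α : BalHom A B) (hα : ∀ a, prec a a → prec' (α.toAlgHom a) (α.toAlgHom a)) :
    spec hp' ⟶ spec hp where
  toFun := MaxLIdeal.comap α
  continuous := MaxLIdeal.continuous_comap α
  monotone := fun (x y : MaxLIdeal B) h => (below_subset_iff hp _ _).2 fun c hc => by
    rw [MaxLIdeal.val_comap, MaxLIdeal.val_comap]
    exact (below_subset_iff hp' x y).1 h _ (hα _ hc)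

end Proximity

/-! ### Algebras with a Nachbin proximity -/

/-- Bounded archimedean `ℓ`-algebras with a Nachbin proximity. -/
structure Nbal : Type (u + 1) where
  carrier : Type u
  [commRing : CommRing carrier]
  [lattice : Lattice carrier]
  [algebra : Algebra ℝ carrier]
  [isBal : IsBal carrier]
  prec : carrier → carrier → Prop
  isNachbin : IsNachbinProximity prec

attribute [instance] Nbal.commRing Nbal.lattice Nbal.algebra Nbal.isBal

/-- Morphisms: unital `ℓ`-algebra homomorphisms that preserve proximity. -/
@[ext]
structure Nbal.Hom (A B : Nbal.{u}) where
  hom : BalHom A.carrier B.carrier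
  map_prec : ∀ a b, A.prec a b → B.prec (hom.toAlgHom a) (hom.toAlgHom b)

instance : Category Nbal.{u} where
  Hom := Nbal.Hom
  id A := ⟨BalHom.id A.carrier, fun _ _ h => h⟩
  comp f g := ⟨g.hom.comp f.hom, fun _ _ h => g.map_prec _ _ (f.map_prec _ _ h)⟩

/-- The contravariant functor from algebras with a Nachbin proximity to Nachbin spaces, sending
an algebra to its space of maximal `ℓ`-ideals and `α` to `α⁻¹`. -/
def functorX : Nbal.{u}ᵒᵖ ⥤ Nach.{u} where
  obj A := spec A.unop.isNachbin.isOrdering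
  map α := specMap _ _ α.unop.hom fun a => α.unop.map_prec a a
  map_id _ := rfl
  map_comp _ _ := rfl

/-! ### Continuous functions on a Nachbin space -/

instance {X : Type u} [TopologicalSpace X] [CompactSpace X] : IsBal C(X, ℝ) where
  add_le_add_right' _ _ _ h x := add_le_add (h x) le_rfl
  mul_nonneg' _ _ ha hb x := mul_nonneg (ha x) (hb x)
  smul_nonneg' _ _ hr ha x := mul_nonneg hr (ha x)
  bounded' f := by
    obtain ⟨n, hn⟩ := exists_nat_ge ‖f‖
    refine ⟨n, fun x => ?_, fun x => ?_⟩
    · have := (abs_le.1 ((f.norm_coe_le_norm x).trans hn)).1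
      simpa using this
    · have := (abs_le.1 ((f.norm_coe_le_norm x).trans hn)).2
      simpa using this
  archimedean' f g h x := by
    by_contra! hlt
    change 0 < f x at hlt
    obtain ⟨n, hn⟩ := exists_nat_gt (g x / f x)
    rw [div_lt_iff₀ hlt] at hn
    have := h n x
    simp at this
    linarith

/-- Continuous order-preserving functions separate the points of a Nachbin space. -/
theorem exists_monotone_lt (X : Nach.{u}) {x y : X.carrier} (hxy : ¬ x ≤ y) :
    ∃ f : C(X.carrier, ℝ), Monotone f ∧ f y < f x := by
  have hdown : ∀ c : Set X.carrier, IsClosed c → IsClosed {z | ∃ a ∈ c, z ≤ a} := fun c hc => by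
    have : {z | ∃ a ∈ c, z ≤ a} = Prod.fst '' ({p : X.carrier × X.carrier | p.1 ≤ p.2} ∩
        (Set.univ ×ˢ c)) := by
      ext z; constructor
      · rintro ⟨a, ha, h⟩; exact ⟨(z, a), ⟨h, trivial, ha⟩, rfl⟩
      · rintro ⟨⟨z, a⟩, ⟨h, -, ha⟩, rfl⟩; exact ⟨a, ha, h⟩
    rw [this]
    exact ((OrderClosedTopology.isClosed_le'.inter
      (isClosed_univ.prod hc)).isCompact.image continuous_fst).isClosed
  have hup : ∀ c : Set X.carrier, IsClosed c → IsClosed {z | ∃ a ∈ c, a ≤ z} := fun c hc => by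
    have : {z | ∃ a ∈ c, a ≤ z} = Prod.snd '' ({p : X.carrier × X.carrier | p.1 ≤ p.2} ∩
        (c ×ˢ Set.univ)) := by
      ext z; constructor
      · rintro ⟨a, ha, h⟩; exact ⟨(a, z), ⟨h, ha, trivial⟩, rfl⟩
      · rintro ⟨⟨a, z⟩, ⟨h, ha, -⟩, rfl⟩; exact ⟨a, ha, h⟩
    rw [this]
    exact ((OrderClosedTopology.isClosed_le'.inter
      (hc.prod isClosed_univ)).isCompact.image continuous_snd).isClosed
  let P : Set X.carrier → Set X.carrier → Prop := fun _ U => IsLowerSet U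
  let c₀ : Urysohns.CU P :=
    { C := {y}
      U := {z | ¬ x ≤ z}
      P_C_U := fun a b hba ha hb => ha (le_trans hb hba)
      closed_C := isClosed_singleton
      open_U := by
        have : IsClosed {z | x ≤ z} := isClosed_le continuous_const continuous_id
        exact this.isOpen_compl
      subset := by rintro _ rfl; exact hxy
      hP := by
        intro c u hc hu hou hcu
        obtain ⟨v, hv, h1, h2⟩ := normal_exists_closure_subset (hdown c hc) hou
          (by rintro z ⟨a, ha, h⟩; exact hu h (hcu ha))
        refine ⟨{z | ∃ a ∈ vᶜ, a ≤ z}ᶜ, (hup _ hv.isClosed_compl).isOpen_compl, ?_, ?_, ?_, hu⟩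
        · rintro z hz ⟨a, ha, h⟩
          exact ha (h1 ⟨z, hz, h⟩)
        · refine (closure_mono fun z hz => ?_).trans h2
          by_contra hzv
          exact hz ⟨z, hzv, le_rfl⟩
        · rintro a b hba ha ⟨d, hd, h⟩
          exact ha ⟨d, hd, h.trans hba⟩ }
  have happ : ∀ (n : ℕ) (c : Urysohns.CU P), Monotone (c.approx n) := by
    intro n
    induction n with
    | zero =>
      intro c a b hab
      simp only [Urysohns.CU.approx]
      by_cases hb : b ∈ c.U
      · rw [Set.indicator_of_notMem (by simpa using c.P_C_U hab hb),
          Set.indicator_of_notMem (by simpa using hb)]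
      · rw [Set.indicator_of_mem (show b ∈ c.Uᶜ from hb)]
        exact Set.indicator_apply_le' (fun _ => le_rfl) fun _ => zero_le_one
    | succ n ih =>
      intro c a b hab
      simp only [Urysohns.CU.approx]
      exact midpoint_le_midpoint (ih _ hab) (ih _ hab)
  refine ⟨⟨c₀.lim, c₀.continuous_lim⟩, fun a b hab => ?_, ?_⟩
  · exact le_of_tendsto_of_tendsto' (c₀.tendsto_approx_atTop a) (c₀.tendsto_approx_atTop b)
      fun n => happ n c₀ hab
  · have h1 : c₀.lim y = 0 := c₀.lim_of_mem_C y rfl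
    have h2 : c₀.lim x = 1 := c₀.lim_of_notMem_U x (fun h => h le_rfl)
    change c₀.lim y < c₀.lim x
    rw [h1, h2]; exact zero_lt_one

/-- The proximity on `C(X)`: there is a continuous order-preserving function in between. -/
def precC (X : Nach.{u}) (f g : C(X.carrier, ℝ)) : Prop :=
  ∃ c ∈ {c : C(X.carrier, ℝ) | Monotone c}, f ≤ c ∧ c ≤ g

theorem precC_self {X : Nach.{u}} {f : C(X.carrier, ℝ)} : precC X f f ↔ Monotone f := by
  constructor
  · rintro ⟨c, hc, h1, h2⟩
    rwa [le_antisymm h1 h2]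
  · exact fun h => ⟨f, h, le_rfl, le_rfl⟩

theorem precC_isNachbinProximity (X : Nach.{u}) : IsNachbinProximity (precC X) := by
  refine { isReflexiveProximity_of_set {c : C(X.carrier, ℝ) | Monotone c} ?_ ?_ ?_ ?_ ?_ ?_ with
    dense := ?_ }
  · exact fun r _ _ _ => le_rfl
  · exact fun f hf g hg a b h => sup_le_sup (hf h) (hg h)
  · exact fun f hf g hg a b h => inf_le_inf (hf h) (hg h)
  · exact fun f hf g hg a b h => add_le_add (hf h) (hg h)
  · exact fun f hf g hg hf0 hg0 a b h => mul_le_mul (hf h) (hg h) (hg0 a) (hf0 b)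
  · exact fun r hr f hf a b h => mul_le_mul_of_nonneg_left (hf h) hr
  intro a ε hε
  let L : Set C(X.carrier, ℝ) := {f | ∃ c d : C(X.carrier, ℝ), Monotone c ∧ Monotone d ∧ f = c - d}
  have hL : closure L = ⊤ := by
    have hinf : ∀ f ∈ L, ∀ g ∈ L, f ⊓ g ∈ L := by
      rintro _ ⟨c, d, hc, hd, rfl⟩ _ ⟨c', d', hc', hd', rfl⟩
      refine ⟨(c + d') ⊓ (c' + d), d + d', fun a b h => ?_, fun a b h => ?_, ?_⟩
      · exact inf_le_inf (add_le_add (hc h) (hd' h)) (add_le_add (hc' h) (hd h))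
      · exact add_le_add (hd h) (hd' h)
      · ext x
        change min (c x - d x) (c' x - d' x) = min (c x + d' x) (c' x + d x) - (d x + d' x)
        rw [← min_sub_sub_right]; congr 1 <;> ring
    have hneg : ∀ f ∈ L, -f ∈ L := by
      rintro _ ⟨c, d, hc, hd, rfl⟩
      exact ⟨d, c, hd, hc, by simp⟩
    refine ContinuousMap.sublattice_closure_eq_top L ⟨0, 0, 0, monotone_const, monotone_const,
      by simp⟩ hinf ?_ ?_
    · intro f hf g hg
      have := hneg _ (hinf _ (hneg _ hf) _ (hneg _ hg))
      rwa [neg_inf, neg_neg, neg_neg] at this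
    · intro v x y
      by_cases hxy : x = y
      · subst hxy
        exact ⟨ContinuousMap.const _ (v x),
          ⟨ContinuousMap.const _ (v x), 0, monotone_const, monotone_const, by simp⟩, rfl, rfl⟩
      have hsep : ∃ f : C(X.carrier, ℝ), Monotone f ∧ f x ≠ f y := by
        by_cases h : x ≤ y
        · obtain ⟨f, hf, hlt⟩ := exists_monotone_lt X (fun h' => hxy (le_antisymm h h'))
          exact ⟨f, hf, hlt.ne⟩
        · obtain ⟨f, hf, hlt⟩ := exists_monotone_lt X h
          exact ⟨f, hf, hlt.ne'⟩
      obtain ⟨f, hf, hne⟩ := hsep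
      have hne' : f y - f x ≠ 0 := sub_ne_zero.2 (Ne.symm hne)
      let k : ℝ := (v y - v x) / (f y - f x)
      let g : C(X.carrier, ℝ) := ContinuousMap.const _ (v x - k * f x) + k • f
      refine ⟨g, ?_, ?_, ?_⟩
      · rcases le_total 0 k with hk | hk
        · refine ⟨g, 0, fun a b h => ?_, monotone_const, by simp⟩
          exact add_le_add le_rfl (mul_le_mul_of_nonneg_left (hf h) hk)
        · refine ⟨ContinuousMap.const _ (v x - k * f x), (-k) • f, monotone_const,
            fun a b h => ?_, by simp [g]⟩
          exact mul_le_mul_of_nonneg_left (hf h) (neg_nonneg.2 hk)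
      · change v x - k * f x + k * f x = v x
        ring
      · change v x - k * f x + k * f y = v y
        simp only [k]; field_simp; ring
  have ha : a ∈ closure L := by rw [hL]; trivial
  obtain ⟨b, ⟨c, d, hc, hd, rfl⟩, hlt⟩ := Metric.mem_closure_iff.1 ha (ε / 2) (by positivity)
  refine ⟨c, d, precC_self.2 hc, precC_self.2 hd, ?_⟩
  refine lt_of_le_of_lt (balNorm_le (r := ε / 2) (by positivity) fun x => ?_) (by linarith)
  rw [dist_eq_norm] at hlt
  have := ((a - (c - d)).norm_coe_le_norm x).trans hlt.le
  simpa [Real.norm_eq_abs] using this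

/-- Composition with a continuous map as a homomorphism of algebras of continuous functions. -/
def compHom {X : Type u} {Y : Type v} [TopologicalSpace X] [TopologicalSpace Y] (φ : C(X, Y)) :
    BalHom C(Y, ℝ) C(X, ℝ) where
  toFun f := f.comp φ
  map_one' := rfl
  map_mul' _ _ := rfl
  map_zero' := rfl
  map_add' _ _ := rfl
  commutes' _ := rfl
  map_sup' _ _ := rfl
  map_inf' _ _ := rfl

/-- The contravariant functor from Nachbin spaces to algebras with a Nachbin proximity. -/
def functorC : Nach.{u}ᵒᵖ ⥤ Nbal.{u} where
  obj X :=
    { carrier := C(X.unop.carrier, ℝ)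
      prec := precC X.unop
      isNachbin := precC_isNachbinProximity X.unop }
  map φ :=
    { hom := compHom ⟨φ.unop.toFun, φ.unop.continuous⟩
      map_prec := by
        rintro f g ⟨c, hc, h1, h2⟩
        exact ⟨c.comp ⟨φ.unop.toFun, φ.unop.continuous⟩,
          fun a b h => hc (φ.unop.monotone h), fun x => h1 _, fun x => h2 _⟩ }
  map_id _ := rfl
  map_comp _ _ := rfl

/-! ### Bounded archimedean lattice-ordered semialgebras -/

/-- `ℓ`-monoids: commutative monoids with a lattice order such that adding a fixed element
preserves and reflects the order and preserves joins and meets. -/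
class LMonoid (S : Type u) extends AddCommMonoid S, Lattice S where
  le_iff_add_le_add' : ∀ a b c : S, a ≤ b ↔ a + c ≤ b + c
  sup_add' : ∀ a b c : S, (a ⊔ b) + c = (a + c) ⊔ (b + c)
  inf_add' : ∀ a b c : S, (a ⊓ b) + c = (a + c) ⊓ (b + c)

instance {S : Type u} [LMonoid S] : IsOrderedCancelAddMonoid S where
  add_le_add_left a b h c := (LMonoid.le_iff_add_le_add' a b c).1 h
  le_of_add_le_add_left a b c h := (LMonoid.le_iff_add_le_add' b c a).2 (by
    rwa [add_comm b, add_comm c])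

instance : LMonoid ℝ where
  le_iff_add_le_add' a b c := (add_le_add_iff_right c).symm
  sup_add' a b c := (max_add_add_right a b c).symm
  inf_add' a b c := (min_add_add_right a b c).symm

/-- The positive cone. -/
abbrev PosCone (S : Type u) [LMonoid S] : Type u := {a : S // 0 ≤ a}

/-- Morphisms of `ℓ`-monoids: lattice morphisms that preserve addition. -/
@[ext]
structure LMonoidHom (S : Type u) (T : Type v) [LMonoid S] [LMonoid T] where
  toFun : S → T
  map_add' : ∀ a b, toFun (a + b) = toFun a + toFun b
  map_sup' : ∀ a b, toFun (a ⊔ b) = toFun a ⊔ toFun b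
  map_inf' : ∀ a b, toFun (a ⊓ b) = toFun a ⊓ toFun b

namespace LMonoidHom

variable {S : Type u} {T : Type v} {U : Type w} [LMonoid S] [LMonoid T] [LMonoid U]

theorem map_zero (f : LMonoidHom S T) : f.toFun 0 = 0 := by
  have := f.map_add' 0 0
  rw [add_zero] at this
  exact add_left_cancel (a := f.toFun 0) (by rw [add_zero]; exact this.symm)

theorem monotone (f : LMonoidHom S T) : Monotone f.toFun := fun a b h => by
  rw [← sup_eq_right, ← f.map_sup', sup_eq_right.2 h]

/-- The map between the positive cones. -/
def pos (f : LMonoidHom S T) (a : PosCone S) : PosCone T :=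
  ⟨f.toFun a.1, f.map_zero ▸ f.monotone a.2⟩

/-- Composition, `g` after `f`. -/
def comp (g : LMonoidHom T U) (f : LMonoidHom S T) : LMonoidHom S U where
  toFun a := g.toFun (f.toFun a)
  map_add' a b := by rw [f.map_add', g.map_add']
  map_sup' a b := by rw [f.map_sup', g.map_sup']
  map_inf' a b := by rw [f.map_inf', g.map_inf']

end LMonoidHom

/-- Bounded archimedean `ℓ`-semialgebras: `ℓ`-monoids with a commutative multiplication on the
positive cone that distributes over addition and is monotone, and with a unital morphism `ρ` of
`ℓ`-monoids from the reals that preserves multiplication of nonnegative elements. -/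
class SbalAlg (S : Type u) extends LMonoid S where
  [posMul : CommMonoid (PosCone S)]
  mul_add' : ∀ a b c : PosCone S, a * (b + c) = a * b + a * c
  mul_le_mul' : ∀ a b c : PosCone S, a ≤ b → a * c ≤ b * c
  ρ : LMonoidHom ℝ S
  ρ_one : ρ.toFun 1 = (1 : PosCone S).1
  ρ_mul : ∀ r s : PosCone ℝ, ρ.toFun (r.1 * s.1) = (ρ.pos r * ρ.pos s).1
  bounded' : ∀ a : S, ∃ r : ℝ, 0 ≤ r ∧ ρ.toFun (-r) ≤ a ∧ a ≤ ρ.toFun r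
  archimedean' : ∀ a b c d : S, (∀ n : ℕ, n • a + b ≤ n • c + d) → a ≤ c

namespace SbalAlg

variable {S : Type u} [SbalAlg S]

theorem pos_mul_zero (a : PosCone S) : letI := posMul (S := S); a * 0 = 0 := by
  let := posMul (S := S)
  have := mul_add' a 0 0
  rw [add_zero] at this
  exact add_left_cancel (a := a * 0) (by rw [add_zero]; exact this.symm)

instance : CommSemiring (PosCone S) :=
  { (inferInstance : AddCommMonoid (PosCone S)), posMul (S := S) with
    left_distrib := mul_add'
    right_distrib := fun a b c => by
      let := posMul (S := S)
      change (a + b) * c = a * c + b * c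
      rw [mul_comm, mul_add', mul_comm c a, mul_comm c b]
    zero_mul := fun a => by
      let := posMul (S := S)
      change 0 * a = 0
      rw [mul_comm, pos_mul_zero]
    mul_zero := pos_mul_zero }

theorem ρ_zero : (ρ (S := S)).toFun 0 = 0 := ρ.map_zero

theorem ρ_add_neg (r : ℝ) : (ρ (S := S)).toFun r + ρ.toFun (-r) = 0 := by
  rw [← ρ.map_add', add_neg_cancel, ρ_zero]

theorem exists_nonneg_add (a : S) : ∃ s : ℝ, 0 ≤ s ∧ 0 ≤ a + ρ.toFun s := by
  obtain ⟨s, hs, h, -⟩ := bounded' a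
  refine ⟨s, hs, ?_⟩
  have := add_le_add h (le_refl (ρ.toFun s))
  rwa [add_comm, ρ_add_neg] at this

/-- A nonnegative real number in the positive cone. -/
def posReal (S : Type u) [SbalAlg S] (r : ℝ) (hr : 0 ≤ r) : PosCone S := ρ.pos ⟨r, hr⟩

theorem posReal_mul (r s : ℝ) (hr : 0 ≤ r) (hs : 0 ≤ s) :
    posReal S r hr * posReal S s hs = posReal S (r * s) (mul_nonneg hr hs) :=
  Subtype.ext (ρ_mul ⟨r, hr⟩ ⟨s, hs⟩).symm

theorem posReal_one : posReal S 1 zero_le_one = 1 := Subtype.ext ρ_one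

/-- The action of nonnegative real numbers: `r a` is `r (a + s) - r s` for any real number
`s ≥ 0` with `a + s ≥ 0`. -/
noncomputable def rsmul (r : ℝ) (hr : 0 ≤ r) (a : S) : S :=
  (posReal S r hr * ⟨a + ρ.toFun (exists_nonneg_add a).choose,
    (exists_nonneg_add a).choose_spec.2⟩).1 + ρ.toFun (-(r * (exists_nonneg_add a).choose))

theorem rsmul_aux (r : ℝ) (hr : 0 ≤ r) (a : S) (s t : ℝ) (hst : s ≤ t) (hs : 0 ≤ a + ρ.toFun s)
    (ht : 0 ≤ a + ρ.toFun t) :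
    (posReal S r hr * ⟨a + ρ.toFun s, hs⟩).1 + ρ.toFun (-(r * s)) =
      (posReal S r hr * ⟨a + ρ.toFun t, ht⟩).1 + ρ.toFun (-(r * t)) := by
  have h1 : (⟨a + ρ.toFun t, ht⟩ : PosCone S)
      = ⟨a + ρ.toFun s, hs⟩ + posReal S (t - s) (sub_nonneg.2 hst) := by
    apply Subtype.ext
    change a + ρ.toFun t = a + ρ.toFun s + ρ.toFun (t - s)
    rw [add_assoc, ← ρ.map_add']; congr 2; ring
  rw [h1, mul_add, posReal_mul]
  change _ = _ + ρ.toFun (r * (t - s)) + ρ.toFun (-(r * t))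
  rw [add_assoc, ← ρ.map_add']; congr 2; ring

theorem rsmul_eq (r : ℝ) (hr : 0 ≤ r) (a : S) (s : ℝ) (hs : 0 ≤ a + ρ.toFun s) :
    rsmul r hr a = (posReal S r hr * ⟨a + ρ.toFun s, hs⟩).1 + ρ.toFun (-(r * s)) := by
  rcases le_total s (exists_nonneg_add a).choose with h | h
  · exact (rsmul_aux r hr a _ _ h _ _).symm
  · exact rsmul_aux r hr a _ _ h _ _

end SbalAlg

open SbalAlg

/-- Morphisms of bounded archimedean `ℓ`-semialgebras: unital morphisms of `ℓ`-monoids that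
preserve multiplication on the positive cone and the action of the nonnegative real numbers. -/
@[ext]
structure SbalHom (S : Type u) (T : Type v) [SbalAlg S] [SbalAlg T] extends LMonoidHom S T where
  map_one' : toLMonoidHom.pos 1 = 1
  map_mul' : ∀ a b, toLMonoidHom.pos (a * b) = toLMonoidHom.pos a * toLMonoidHom.pos b
  map_rsmul' : ∀ (r : ℝ) (hr : 0 ≤ r) (a : S), toFun (rsmul r hr a) = rsmul r hr (toFun a)

namespace SbalHom

variable {S : Type u} {T : Type v} {U : Type w} [SbalAlg S] [SbalAlg T] [SbalAlg U]

theorem rsmul_one (r : ℝ) (hr : 0 ≤ r) : rsmul r hr (1 : PosCone S).1 = ρ.toFun r := by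
  rw [rsmul_eq r hr _ 0 (by rw [ρ_zero, add_zero]; exact (1 : PosCone S).2)]
  have : (⟨(1 : PosCone S).1 + ρ.toFun 0, by rw [ρ_zero, add_zero]; exact (1 : PosCone S).2⟩ :
      PosCone S) = 1 := Subtype.ext (by simp only [ρ_zero, add_zero])
  rw [this, mul_one, mul_zero, neg_zero, ρ_zero, add_zero]; rfl

theorem map_ρ (f : SbalHom S T) (r : ℝ) : f.toFun (ρ.toFun r) = ρ.toFun r := by
  have h0 : ∀ r : ℝ, 0 ≤ r → f.toFun (ρ.toFun r) = ρ.toFun r := fun r hr => by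
    have h1 := f.map_rsmul' r hr (1 : PosCone S).1
    have h2 : f.toFun (1 : PosCone S).1 = (1 : PosCone T).1 := congrArg Subtype.val f.map_one'
    rwa [h2, rsmul_one, rsmul_one] at h1
  rcases le_total 0 r with hr | hr
  · exact h0 r hr
  · have h1 := h0 (-r) (neg_nonneg.2 hr)
    apply add_left_cancel (a := ρ.toFun (-r))
    rw [← h1, ← f.map_add', ← ρ.map_add', h1, ← ρ.map_add', neg_add_cancel, ρ_zero, ρ_zero]
    exact f.map_zero

/-- A constructor that replaces the action by the real numbers themselves. -/
def ofMapρ (f : LMonoidHom S T) (h1 : f.pos 1 = 1) (hmul : ∀ a b, f.pos (a * b) = f.pos a * f.pos b)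
    (hρ : ∀ r : ℝ, f.toFun (ρ.toFun r) = ρ.toFun r) : SbalHom S T where
  toLMonoidHom := f
  map_one' := h1
  map_mul' := hmul
  map_rsmul' r hr a := by
    obtain ⟨s, -, hs⟩ := exists_nonneg_add a
    have hs' : 0 ≤ f.toFun a + ρ.toFun s := by
      rw [← hρ, ← f.map_add', ← f.map_zero]; exact f.monotone hs
    rw [rsmul_eq r hr a s hs, rsmul_eq r hr _ s hs', f.map_add', hρ]
    congr 1
    have h2 := congrArg Subtype.val (hmul (posReal S r hr) ⟨a + ρ.toFun s, hs⟩)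
    have h3 : f.pos (posReal S r hr) = posReal T r hr := Subtype.ext (hρ r)
    have h4 : f.pos ⟨a + ρ.toFun s, hs⟩ = ⟨f.toFun a + ρ.toFun s, hs'⟩ := Subtype.ext (by
      change f.toFun (a + ρ.toFun s) = f.toFun a + ρ.toFun s
      rw [f.map_add', hρ])
    rw [h3, h4] at h2
    exact h2

/-- The identity. -/
def id (S : Type u) [SbalAlg S] : SbalHom S S where
  toFun a := a
  map_add' _ _ := rfl
  map_sup' _ _ := rfl
  map_inf' _ _ := rfl
  map_one' := rfl
  map_mul' _ _ := rfl
  map_rsmul' _ _ _ := rfl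

/-- Composition, `g` after `f`. -/
def comp (g : SbalHom T U) (f : SbalHom S T) : SbalHom S U where
  toLMonoidHom := g.toLMonoidHom.comp f.toLMonoidHom
  map_one' := by
    change g.pos (f.pos 1) = 1
    rw [f.map_one', g.map_one']
  map_mul' a b := by
    change g.pos (f.pos (a * b)) = g.pos (f.pos a) * g.pos (f.pos b)
    rw [f.map_mul', g.map_mul']
  map_rsmul' r hr a := by
    change g.toFun (f.toFun (rsmul r hr a)) = rsmul r hr (g.toFun (f.toFun a))
    rw [f.map_rsmul', g.map_rsmul']

end SbalHom

/-- The category of bounded archimedean `ℓ`-semialgebras. -/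
structure Sbal : Type (u + 1) where
  carrier : Type u
  [sbalAlg : SbalAlg carrier]

attribute [instance] Sbal.sbalAlg

instance : Category Sbal.{u} where
  Hom S T := SbalHom S.carrier T.carrier
  id S := SbalHom.id S.carrier
  comp f g := SbalHom.comp g f

/-! ### Continuous order-preserving functions -/

/-- The continuous order-preserving real functions on a Nachbin space. -/
abbrev Cle (X : Nach.{u}) : Type u := {f : C(X.carrier, ℝ) // Monotone f}

section Cle

variable (X : Nach.{u})

instance : AddCommMonoid (Cle X) where
  add f g := ⟨f.1 + g.1, fun _ _ h => add_le_add (f.2 h) (g.2 h)⟩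
  zero := ⟨0, monotone_const⟩
  add_assoc f g h := Subtype.ext (add_assoc f.1 g.1 h.1)
  zero_add f := Subtype.ext (zero_add f.1)
  add_zero f := Subtype.ext (add_zero f.1)
  add_comm f g := Subtype.ext (add_comm f.1 g.1)
  nsmul n f := ⟨n • f.1, fun _ _ h => nsmul_le_nsmul_right (f.2 h) n⟩
  nsmul_zero f := Subtype.ext (zero_nsmul f.1)
  nsmul_succ n f := Subtype.ext (succ_nsmul f.1 n)

instance : Lattice (Cle X) :=
  Subtype.lattice (fun _ _ hf hg _ _ h => sup_le_sup (hf h) (hg h))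
    (fun _ _ hf hg _ _ h => inf_le_inf (hf h) (hg h))

instance : LMonoid (Cle X) where
  le_iff_add_le_add' f g h := by
    change f.1 ≤ g.1 ↔ f.1 + h.1 ≤ g.1 + h.1
    exact (add_le_add_iff_right h.1).symm
  sup_add' f g h := Subtype.ext (sup_add f.1 g.1 h.1)
  inf_add' f g h := Subtype.ext (inf_add f.1 g.1 h.1)

instance : CommMonoid (PosCone (Cle X)) where
  mul f g := ⟨⟨f.1.1 * g.1.1, fun a b h =>
    mul_le_mul (f.1.2 h) (g.1.2 h) (g.2 a) (f.2 b)⟩, fun a => mul_nonneg (f.2 a) (g.2 a)⟩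
  one := ⟨⟨1, monotone_const⟩, fun _ => zero_le_one⟩
  mul_assoc f g h := Subtype.ext (Subtype.ext (mul_assoc f.1.1 g.1.1 h.1.1))
  one_mul f := Subtype.ext (Subtype.ext (one_mul f.1.1))
  mul_one f := Subtype.ext (Subtype.ext (mul_one f.1.1))
  mul_comm f g := Subtype.ext (Subtype.ext (mul_comm f.1.1 g.1.1))

instance : SbalAlg (Cle X) where
  mul_add' f g h := Subtype.ext (Subtype.ext (mul_add f.1.1 g.1.1 h.1.1))
  mul_le_mul' f g h hfg a := mul_le_mul_of_nonneg_right (hfg a) (h.2 a)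
  ρ :=
    { toFun := fun r => ⟨ContinuousMap.const _ r, monotone_const⟩
      map_add' := fun _ _ => rfl
      map_sup' := fun _ _ => rfl
      map_inf' := fun _ _ => rfl }
  ρ_one := rfl
  ρ_mul _ _ := rfl
  bounded' f := by
    refine ⟨‖f.1‖, norm_nonneg _, fun x => ?_, fun x => ?_⟩
    · exact (abs_le.1 (f.1.norm_coe_le_norm x)).1
    · exact (abs_le.1 (f.1.norm_coe_le_norm x)).2
  archimedean' a b c d h x := by
    have h' : ∀ n : ℕ, n • (a.1 - c.1) ≤ d.1 - b.1 := fun n => by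
      have : n • a.1 + b.1 ≤ n • c.1 + d.1 := h n
      rw [smul_sub, sub_le_iff_le_add, sub_add_eq_add_sub, le_sub_iff_add_le, add_comm d.1]
      exact this
    have := IsBal.archimedean' _ _ h' x
    change a.1 x - c.1 x ≤ 0 at this
    change a.1 x ≤ c.1 x
    linarith

end Cle

/-- The contravariant functor from Nachbin spaces to bounded archimedean `ℓ`-semialgebras, sending
a space to its continuous order-preserving functions. -/
def functorCle : Nach.{u}ᵒᵖ ⥤ Sbal.{u} where
  obj X := { carrier := Cle X.unop }
  map φ := SbalHom.ofMapρ
    { toFun := fun f => ⟨f.1.comp ⟨φ.unop.toFun, φ.unop.continuous⟩,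
        fun _ _ h => f.2 (φ.unop.monotone h)⟩
      map_add' := fun _ _ => rfl
      map_sup' := fun _ _ => rfl
      map_inf' := fun _ _ => rfl } rfl (fun _ _ => rfl) (fun _ => rfl)
  map_id _ := rfl
  map_comp _ _ := rfl

/-! ### The envelope of a bounded archimedean `ℓ`-semialgebra -/

/-- Pairs `(a, b)` and `(c, d)` are identified if `a + d = b + c`. -/
def envSetoid (S : Type u) [SbalAlg S] : Setoid (S × S) where
  r p q := p.1 + q.2 = p.2 + q.1
  iseqv :=
    { refl := fun p => add_comm _ _
      symm := fun {p q} h => by rw [add_comm q.1, add_comm q.2, h]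
      trans := fun {p q t} h h' => by
        apply add_left_cancel (a := q.1 + q.2)
        calc q.1 + q.2 + (p.1 + t.2) = (p.1 + q.2) + (q.1 + t.2) := by abel
          _ = (p.2 + q.1) + (q.2 + t.1) := by rw [h, h']
          _ = q.1 + q.2 + (p.2 + t.1) := by abel }

/-- The envelope: formal differences of elements. -/
def Env (S : Type u) [SbalAlg S] : Type u := Quotient (envSetoid S)

namespace Env

variable {S : Type u} [SbalAlg S]

/-- The formal difference of `a` and `b`. -/
def mk (a b : S) : Env S := Quotient.mk (envSetoid S) (a, b)

theorem mk_eq {a b c d : S} : mk a b = mk c d ↔ a + d = b + c :=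
  ⟨fun h => Quotient.exact h, fun h => Quotient.sound h⟩

theorem ind {p : Env S → Prop} (h : ∀ a b, p (mk a b)) (q : Env S) : p q :=
  Quotient.ind (fun x => h x.1 x.2) q

instance : Add (Env S) where
  add := Quotient.map₂ (fun p q => (p.1 + q.1, p.2 + q.2)) (by
    rintro p p' h q q' h'
    change p.1 + q.1 + (p'.2 + q'.2) = p.2 + q.2 + (p'.1 + q'.1)
    replace h : p.1 + p'.2 = p.2 + p'.1 := h
    replace h' : q.1 + q'.2 = q.2 + q'.1 := h'
    rw [add_add_add_comm, h, h', add_add_add_comm])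

theorem mk_add (a b c d : S) : mk a b + mk c d = mk (a + c) (b + d) := rfl

instance : Neg (Env S) where
  neg := Quotient.map (fun p => (p.2, p.1)) (by
    rintro p q h
    change p.2 + q.1 = p.1 + q.2
    exact Eq.symm h)

theorem neg_mk (a b : S) : -mk a b = mk b a := rfl

instance : Zero (Env S) := ⟨mk 0 0⟩

instance : AddCommGroup (Env S) where
  add_assoc := by
    refine ind fun a b => ind fun c d => ind fun e f => ?_
    simp only [mk_add, add_assoc]
  zero_add := by
    refine ind fun a b => ?_
    change mk 0 0 + mk a b = _
    rw [mk_add, zero_add, zero_add]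
  add_zero := by
    refine ind fun a b => ?_
    change mk a b + mk 0 0 = _
    rw [mk_add, add_zero, add_zero]
  add_comm := by
    refine ind fun a b => ind fun c d => ?_
    rw [mk_add, mk_add, add_comm a, add_comm b]
  neg_add_cancel := by
    refine ind fun a b => ?_
    rw [neg_mk, mk_add]
    exact mk_eq.2 (by abel)
  nsmul := nsmulRec
  zsmul := zsmulRec

theorem zero_def : (0 : Env S) = mk 0 0 := rfl

theorem nsmul_mk (n : ℕ) (a b : S) : n • mk a b = mk (n • a) (n • b) := by
  induction n with
  | zero => simp [zero_def]
  | succ n ih => rw [succ_nsmul, ih, mk_add, succ_nsmul, succ_nsmul]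

theorem exists_pos (a b : S) : ∃ p q : PosCone S, mk a b = mk p.1 q.1 := by
  obtain ⟨r, hr, h1⟩ := exists_nonneg_add a
  obtain ⟨s, hs, h2⟩ := exists_nonneg_add b
  have h3 : 0 ≤ ρ (S := S).toFun r := by rw [← ρ_zero]; exact ρ.monotone hr
  have h4 : 0 ≤ ρ (S := S).toFun s := by rw [← ρ_zero]; exact ρ.monotone hs
  refine ⟨⟨a + ρ.toFun r + ρ.toFun s, add_nonneg h1 h4⟩,
    ⟨b + ρ.toFun s + ρ.toFun r, add_nonneg h2 h3⟩, mk_eq.2 ?_⟩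
  change a + (b + ρ.toFun s + ρ.toFun r) = b + (a + ρ.toFun r + ρ.toFun s)
  abel

theorem ind_pos {p : Env S → Prop} (h : ∀ a b : PosCone S, p (mk a.1 b.1)) (q : Env S) : p q := by
  induction q using ind with
  | h a b =>
    obtain ⟨c, d, e⟩ := exists_pos a b
    rw [e]; exact h c d

theorem mk_eq_pos {a b c d : PosCone S} : mk a.1 b.1 = mk c.1 d.1 ↔ a + d = b + c := by
  rw [mk_eq]
  exact ⟨fun h => Subtype.ext h, fun h => congrArg Subtype.val h⟩

/-- Multiplication of formal differences of nonnegative elements. -/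
def mulPos (a b c d : PosCone S) : Env S := mk (a * c + b * d).1 (a * d + b * c).1

theorem mulPos_comm (a b c d : PosCone S) : mulPos a b c d = mulPos c d a b := by
  unfold mulPos
  rw [mul_comm a c, mul_comm b d, mul_comm a d, mul_comm b c, add_comm (d * a)]

theorem mulPos_congr_left {a b a' b' : PosCone S} (h : mk a.1 b.1 = mk a'.1 b'.1)
    (c d : PosCone S) : mulPos a b c d = mulPos a' b' c d := by
  rw [mk_eq_pos] at h
  refine mk_eq_pos.2 ?_
  calc a * c + b * d + (a' * d + b' * c) = (a + b') * c + (b + a') * d := by ring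
    _ = (b + a') * c + (a + b') * d := by rw [h]
    _ = a * d + b * c + (a' * c + b' * d) := by ring

theorem mulPos_congr {a b a' b' c d c' d' : PosCone S} (h : mk a.1 b.1 = mk a'.1 b'.1)
    (h' : mk c.1 d.1 = mk c'.1 d'.1) : mulPos a b c d = mulPos a' b' c' d' := by
  rw [mulPos_congr_left h, mulPos_comm, mulPos_congr_left h', mulPos_comm]

theorem exists_rep (x : Env S) : ∃ p : PosCone S × PosCone S, x = mk p.1.1 p.2.1 := by
  induction x using ind_pos with
  | h a b => exact ⟨(a, b), rfl⟩

/-- Multiplication, defined through nonnegative representatives. -/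
noncomputable instance : Mul (Env S) where
  mul x y := mulPos (exists_rep x).choose.1 (exists_rep x).choose.2
    (exists_rep y).choose.1 (exists_rep y).choose.2

theorem mk_mul (a b c d : PosCone S) :
    mk a.1 b.1 * mk c.1 d.1 = mk (a * c + b * d).1 (a * d + b * c).1 :=
  mulPos_congr (exists_rep (mk a.1 b.1)).choose_spec.symm
    (exists_rep (mk c.1 d.1)).choose_spec.symm

instance : One (Env S) := ⟨mk (1 : PosCone S).1 (0 : PosCone S).1⟩

theorem one_def : (1 : Env S) = mk (1 : PosCone S).1 (0 : PosCone S).1 := rfl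

theorem mk_add_pos (a b c d : PosCone S) :
    mk a.1 b.1 + mk c.1 d.1 = mk (a + c).1 (b + d).1 := rfl

theorem env_mul_comm (x y : Env S) : x * y = y * x := by
  induction x using ind_pos with
  | h a b =>
  induction y using ind_pos with
  | h c d =>
    rw [mk_mul, mk_mul]
    exact mulPos_comm a b c d

theorem env_one_mul (x : Env S) : 1 * x = x := by
  induction x using ind_pos with
  | h a b =>
    rw [one_def, mk_mul]
    congr 2 <;> ring

theorem env_mul_add (x y z : Env S) : x * (y + z) = x * y + x * z := by
  induction x using ind_pos with
  | h a b =>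
  induction y using ind_pos with
  | h c d =>
  induction z using ind_pos with
  | h e f =>
    rw [mk_add_pos, mk_mul, mk_mul, mk_mul, mk_add_pos]
    congr 2 <;> ring

theorem env_mul_assoc (x y z : Env S) : x * y * z = x * (y * z) := by
  induction x using ind_pos with
  | h a b =>
  induction y using ind_pos with
  | h c d =>
  induction z using ind_pos with
  | h e f =>
    rw [mk_mul, mk_mul, mk_mul, mk_mul]
    congr 2 <;> ring

noncomputable instance : CommRing (Env S) :=
  { (inferInstance : AddCommGroup (Env S)) with
    mul_assoc := env_mul_assoc
    one_mul := env_one_mul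
    mul_one := fun x => by rw [env_mul_comm, env_one_mul]
    left_distrib := env_mul_add
    right_distrib := fun x y z => by
      rw [env_mul_comm, env_mul_add, env_mul_comm z, env_mul_comm z]
    zero_mul := fun x => by
      rw [env_mul_comm]
      have := env_mul_add x 0 0
      rw [add_zero] at this
      exact (left_eq_add.1 this)
    mul_zero := fun x => by
      have := env_mul_add x 0 0
      rw [add_zero] at this
      exact (left_eq_add.1 this)
    mul_comm := env_mul_comm }

theorem mk_ρ (r p q : ℝ) (hp : 0 ≤ p) (hq : 0 ≤ q) (h : r = p - q) :
    mk (ρ.toFun r) (0 : S) = mk (posReal S p hp).1 (posReal S q hq).1 := by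
  rw [mk_eq]
  change ρ.toFun r + ρ.toFun q = 0 + ρ.toFun p
  rw [zero_add, ← ρ.map_add', h, sub_add_cancel]

/-- The real numbers inside the envelope. -/
noncomputable def realHom (S : Type u) [SbalAlg S] : ℝ →+* Env S where
  toFun r := mk (ρ.toFun r) 0
  map_one' := by rw [ρ_one]; rfl
  map_zero' := by rw [ρ_zero]; rfl
  map_add' r s := by rw [ρ.map_add', mk_add, add_zero]
  map_mul' r s := by
    have e : ∀ r : ℝ, r = max r 0 - max (-r) 0 := fun r => by
      rcases le_total 0 r with h | h
      · rw [max_eq_left h, max_eq_right (by linarith)]; ring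
      · rw [max_eq_right h, max_eq_left (by linarith)]; ring
    have hr := le_max_right r 0
    have hr' := le_max_right (-r) 0
    have hs := le_max_right s 0
    have hs' := le_max_right (-s) 0
    rw [mk_ρ r _ _ hr hr' (e r), mk_ρ s _ _ hs hs' (e s), mk_mul, posReal_mul, posReal_mul,
      posReal_mul, posReal_mul, mk_eq]
    change ρ.toFun (r * s) + (ρ.toFun (max r 0 * max (-s) 0) + ρ.toFun (max (-r) 0 * max s 0)) =
      0 + (ρ.toFun (max r 0 * max s 0) + ρ.toFun (max (-r) 0 * max (-s) 0))
    rw [zero_add, ← ρ.map_add', ← ρ.map_add', ← ρ.map_add']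
    congr 1
    conv_lhs => rw [e r, e s]
    have h1 : max (max r 0 - max (-r) 0) 0 = max r 0 := by rw [← e r]
    have h2 : max (max s 0 - max (-s) 0) 0 = max s 0 := by rw [← e s]
    have h3 : max (-(max r 0 - max (-r) 0)) 0 = max (-r) 0 := by rw [← e r]
    have h4 : max (-(max s 0 - max (-s) 0)) 0 = max (-s) 0 := by rw [← e s]
    rw [h1, h2, h3, h4]
    ring

/-- The real algebra structure; by `smul_mk` below a nonnegative real number acts by
`r • mk a b = mk (r a) (r b)`. -/
noncomputable instance : Algebra ℝ (Env S) := (realHom S).toAlgebra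

theorem algebraMap_eq (r : ℝ) : algebraMap ℝ (Env S) r = mk (ρ.toFun r) 0 := rfl

theorem smul_mk_pos (r : ℝ) (hr : 0 ≤ r) (a b : PosCone S) :
    r • mk a.1 b.1 = mk (posReal S r hr * a).1 (posReal S r hr * b).1 := by
  rw [Algebra.smul_def, algebraMap_eq]
  change mk (posReal S r hr).1 (0 : PosCone S).1 * mk a.1 b.1 = _
  rw [mk_mul, zero_mul, zero_mul, add_zero, add_zero]

theorem smul_mk (r : ℝ) (hr : 0 ≤ r) (a b : S) :
    r • mk a b = mk (rsmul r hr a) (rsmul r hr b) := by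
  obtain ⟨s, hs, h1⟩ := exists_nonneg_add a
  obtain ⟨t, ht, h2⟩ := exists_nonneg_add b
  rw [rsmul_eq r hr a s h1, rsmul_eq r hr b t h2]
  have h3 : 0 ≤ a + ρ.toFun s + ρ.toFun t := add_nonneg h1 (posReal S t ht).2
  have h4 : 0 ≤ b + ρ.toFun t + ρ.toFun s := add_nonneg h2 (posReal S s hs).2
  have e : mk a b = mk ((⟨a + ρ.toFun s, h1⟩ : PosCone S) + posReal S t ht).1
      ((⟨b + ρ.toFun t, h2⟩ : PosCone S) + posReal S s hs).1 := by
    rw [mk_eq]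
    change a + (b + ρ.toFun t + ρ.toFun s) = b + (a + ρ.toFun s + ρ.toFun t)
    abel
  rw [e, smul_mk_pos r hr, mul_add, mul_add, posReal_mul, posReal_mul, mk_eq]
  set u := (posReal S r hr * ⟨a + ρ.toFun s, h1⟩).1
  set v := (posReal S r hr * ⟨b + ρ.toFun t, h2⟩).1
  change u + ρ.toFun (r * t) + (v + ρ.toFun (-(r * t))) =
    v + ρ.toFun (r * s) + (u + ρ.toFun (-(r * s)))
  rw [add_add_add_comm, ρ_add_neg, add_add_add_comm, ρ_add_neg, add_comm u]

instance : LE (Env S) where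
  le := Quotient.lift₂ (fun p q : S × S => p.1 + q.2 ≤ q.1 + p.2) (by
    rintro ⟨a, b⟩ ⟨c, d⟩ ⟨a', b'⟩ ⟨c', d'⟩ h h'
    replace h : a + b' = b + a' := h
    replace h' : c + d' = d + c' := h'
    apply propext
    change a + d ≤ c + b ↔ a' + d' ≤ c' + b'
    rw [← add_le_add_iff_right (b' + d' : S), ← add_le_add_iff_right (b + d : S) (b := a' + d')]
    have e1 : a + d + (b' + d') = a' + d' + (b + d) := by
      calc a + d + (b' + d') = (a + b') + (d + d') := by abel
        _ = (b + a') + (d + d') := by rw [h]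
        _ = _ := by abel
    have e2 : c + b + (b' + d') = c' + b' + (b + d) := by
      calc c + b + (b' + d') = (c + d') + (b + b') := by abel
        _ = (d + c') + (b + b') := by rw [h']
        _ = _ := by abel
    rw [e1, e2])

theorem mk_le {a b c d : S} : mk a b ≤ mk c d ↔ a + d ≤ c + b := Iff.rfl

instance : PartialOrder (Env S) where
  le_refl := ind fun a b => le_rfl
  le_trans := by
    refine ind fun a b => ind fun c d => ind fun e f => ?_
    intro h h'
    rw [mk_le] at *
    apply le_of_add_le_add_right (a := d + c)
    calc a + f + (d + c) = (a + d) + (c + f) := by abel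
      _ ≤ (c + b) + (e + d) := add_le_add h h'
      _ = _ := by abel
  le_antisymm := by
    refine ind fun a b => ind fun c d => ?_
    intro h h'
    rw [mk_le] at *
    rw [mk_eq, add_comm b]
    exact le_antisymm h h'

theorem isLUB_mk (a b c d : S) : IsLUB {mk a b, mk c d} (mk ((a + d) ⊔ (c + b)) (b + d)) := by
  constructor
  · rintro x (rfl | rfl)
    · rw [mk_le, show a + (b + d) = (a + d) + b by abel]
      exact add_le_add le_sup_left le_rfl
    · rw [mk_le, show c + (b + d) = (c + b) + d by abel]
      exact add_le_add le_sup_right le_rfl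
  · intro x hx
    induction x using ind with
    | h e f =>
      have h1 : a + f ≤ e + b := mk_le.1 (hx (Or.inl rfl))
      have h2 : c + f ≤ e + d := mk_le.1 (hx (Or.inr rfl))
      rw [mk_le, LMonoid.sup_add']
      refine sup_le ?_ ?_
      · calc a + d + f = (a + f) + d := by abel
          _ ≤ e + b + d := add_le_add h1 le_rfl
          _ = _ := by abel
      · calc c + b + f = (c + f) + b := by abel
          _ ≤ e + d + b := add_le_add h2 le_rfl
          _ = _ := by abel

theorem isGLB_mk (a b c d : S) : IsGLB {mk a b, mk c d} (mk ((a + d) ⊓ (c + b)) (b + d)) := by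
  constructor
  · rintro x (rfl | rfl)
    · rw [mk_le, show a + (b + d) = (a + d) + b by abel]
      exact add_le_add inf_le_left le_rfl
    · rw [mk_le, show c + (b + d) = (c + b) + d by abel]
      exact add_le_add inf_le_right le_rfl
  · intro x hx
    induction x using ind with
    | h e f =>
      have h1 : e + b ≤ a + f := mk_le.1 (hx (Or.inl rfl))
      have h2 : e + d ≤ c + f := mk_le.1 (hx (Or.inr rfl))
      rw [mk_le, LMonoid.inf_add']
      refine le_inf ?_ ?_
      · calc e + (b + d) = e + b + d := by abel
          _ ≤ (a + f) + d := add_le_add h1 le_rfl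
          _ = _ := by abel
      · calc e + (b + d) = e + d + b := by abel
          _ ≤ (c + f) + b := add_le_add h2 le_rfl
          _ = _ := by abel

theorem exists_isLUB (x y : Env S) : ∃ z, IsLUB {x, y} z := by
  induction x using ind with
  | h a b =>
  induction y using ind with
  | h c d => exact ⟨_, isLUB_mk a b c d⟩

theorem exists_isGLB (x y : Env S) : ∃ z, IsGLB {x, y} z := by
  induction x using ind with
  | h a b =>
  induction y using ind with
  | h c d => exact ⟨_, isGLB_mk a b c d⟩

noncomputable instance : Lattice (Env S) :=
  { (inferInstance : PartialOrder (Env S)) with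
    sup := fun x y => (exists_isLUB x y).choose
    inf := fun x y => (exists_isGLB x y).choose
    le_sup_left := fun x y => (exists_isLUB x y).choose_spec.1 (Or.inl rfl)
    le_sup_right := fun x y => (exists_isLUB x y).choose_spec.1 (Or.inr rfl)
    sup_le := fun x y z h h' => (exists_isLUB x y).choose_spec.2 (by
      rintro w (rfl | rfl) <;> assumption)
    inf_le_left := fun x y => (exists_isGLB x y).choose_spec.1 (Or.inl rfl)
    inf_le_right := fun x y => (exists_isGLB x y).choose_spec.1 (Or.inr rfl)
    le_inf := fun z x y h h' => (exists_isGLB x y).choose_spec.2 (by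
      rintro w (rfl | rfl) <;> assumption) }

theorem mk_sup (a b c d : S) : mk a b ⊔ mk c d = mk ((a + d) ⊔ (c + b)) (b + d) :=
  isLUB_pair.unique (isLUB_mk a b c d)

theorem mk_inf (a b c d : S) : mk a b ⊓ mk c d = mk ((a + d) ⊓ (c + b)) (b + d) :=
  isGLB_pair.unique (isGLB_mk a b c d)

theorem nonneg_mk {a b : S} : 0 ≤ mk a b ↔ b ≤ a := by
  rw [zero_def, mk_le, zero_add, add_zero]

/-- The embedding of the semialgebra into its envelope. -/
def ε (a : S) : Env S := mk a 0

theorem add_le_add_right'' (x y z : Env S) (h : x ≤ y) : x + z ≤ y + z := by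
  induction x using ind with
  | h a b =>
  induction y using ind with
  | h c d =>
  induction z using ind with
  | h e f =>
    rw [mk_le] at h
    rw [mk_add, mk_add, mk_le]
    calc a + e + (d + f) = (a + d) + (e + f) := by abel
      _ ≤ (c + b) + (e + f) := add_le_add h le_rfl
      _ = _ := by abel

theorem ε_mul_nonneg (t : S) (ht : 0 ≤ ε t) (x : Env S) (hx : 0 ≤ x) : 0 ≤ ε t * x := by
  induction x using ind_pos with
  | h a b =>
    rw [nonneg_mk] at hx
    have ht' : 0 ≤ t := nonneg_mk.1 ht
    change 0 ≤ mk (⟨t, ht'⟩ : PosCone S).1 (0 : PosCone S).1 * _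
    rw [mk_mul, zero_mul, zero_mul, add_zero, add_zero, nonneg_mk]
    rw [mul_comm _ b, mul_comm _ a]
    exact mul_le_mul' b a ⟨t, ht'⟩ hx

theorem ε_sup (a b : S) : ε a ⊔ ε b = ε (a ⊔ b) := by
  unfold ε; rw [mk_sup]; simp

theorem ε_add_algebraMap (a : S) (r : ℝ) : ε a + algebraMap ℝ (Env S) r = ε (a + ρ.toFun r) := by
  unfold ε; rw [algebraMap_eq, mk_add, add_zero]

theorem eq_ε_sub (x : Env S) : ∃ a b : S, x = ε a - ε b := by
  induction x using ind with
  | h a b =>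
    refine ⟨a, b, ?_⟩
    unfold ε
    rw [sub_eq_add_neg, neg_mk, mk_add, add_zero, zero_add]

theorem natCast_eq (n : ℕ) : (n : Env S) = mk (ρ.toFun n) 0 := by
  rw [← map_natCast (algebraMap ℝ (Env S)) n]; rfl

instance : IsWeakBal (Env S) where
  add_le_add_right' := add_le_add_right''
  smul_nonneg' r x hr hx := by
    induction x using ind_pos with
    | h a b =>
      rw [smul_mk_pos r hr, nonneg_mk, mul_comm, mul_comm _ a]
      exact mul_le_mul' b a _ (nonneg_mk.1 hx)
  bounded' x := by
    induction x using ind with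
    | h a b =>
      obtain ⟨r, hr, h1, h2⟩ := bounded' a
      obtain ⟨s, hs, h3, h4⟩ := bounded' b
      obtain ⟨n, hn⟩ := exists_nat_ge (r + s)
      have h5 : ∀ u v : S, u ≤ ρ.toFun r → ρ.toFun (-s) ≤ v → u ≤ ρ.toFun n + v :=
        fun u v hu hv => by
          refine hu.trans (le_trans ?_ (add_le_add (le_refl (ρ.toFun (n : ℝ))) hv))
          rw [← ρ.map_add']
          exact ρ.monotone (by linarith)
      have h6 : ∀ u v : S, u ≤ ρ.toFun s → ρ.toFun (-r) ≤ v → u ≤ ρ.toFun n + v :=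
        fun u v hu hv => by
          refine hu.trans (le_trans ?_ (add_le_add (le_refl (ρ.toFun (n : ℝ))) hv))
          rw [← ρ.map_add']
          exact ρ.monotone (by linarith)
      refine ⟨n, ?_, ?_⟩
      · rw [natCast_eq, neg_mk, mk_le, zero_add, add_comm]
        exact h6 b a h4 h1
      · rw [natCast_eq, mk_le, add_zero]
        exact h5 a b h2 h3
  exists_cone' := ⟨Set.range ε, by
      rintro _ ⟨a, rfl⟩ r
      exact ⟨_, (ε_add_algebraMap a r).symm⟩, by
      rintro _ ⟨a, rfl⟩
      exact ⟨a ⊔ 0, (ε_sup a 0).symm⟩, by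
      rintro _ ⟨t, rfl⟩
      exact ε_mul_nonneg t, fun x => by
      obtain ⟨a, b, h⟩ := eq_ε_sub x
      exact ⟨_, ⟨a, rfl⟩, _, ⟨b, rfl⟩, h⟩⟩

/-- The envelope is archimedean. -/
theorem archimedean (x y : Env S) (h : ∀ n : ℕ, n • x ≤ y) : x ≤ 0 := by
  induction x using ind with
  | h a b =>
  induction y using ind with
  | h c d =>
    have h' : ∀ n : ℕ, n • a + d ≤ n • b + c := fun n => by
      have := h n
      rw [nsmul_mk, mk_le, add_comm c] at this
      exact this
    rw [zero_def, mk_le, add_zero, zero_add]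
    exact archimedean' a d b c h'

/-- The relation on the envelope given by the elements of the semialgebra in between. -/
def prec (S : Type u) [SbalAlg S] (x y : Env S) : Prop := ∃ s : S, x ≤ ε s ∧ ε s ≤ y

theorem prec_self {x : Env S} : prec S x x ↔ ∃ s, x = ε s :=
  ⟨fun ⟨s, h, h'⟩ => ⟨s, le_antisymm h h'⟩, fun ⟨s, h⟩ => ⟨s, h.le, h.ge⟩⟩

theorem isOrdering (S : Type u) [SbalAlg S] : IsOrdering (prec S) where
  posPart x r hx := by
    obtain ⟨s, rfl⟩ := prec_self.1 hx
    refine prec_self.2 ⟨(s + ρ.toFun (-r)) ⊔ 0, ?_⟩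
    rw [posPart_def, sub_eq_add_neg, ← map_neg, ε_add_algebraMap]
    exact ε_sup _ _
  dense x δ hδ := by
    obtain ⟨a, b, rfl⟩ := eq_ε_sub x
    refine ⟨ε a, ε b, prec_self.2 ⟨a, rfl⟩, prec_self.2 ⟨b, rfl⟩, ?_⟩
    rw [sub_self]
    refine lt_of_le_of_lt (balNorm_le le_rfl ?_) hδ
    rw [abs_zero, map_zero]

section map

variable {T : Type v} [SbalAlg T]

/-- The function between envelopes induced by a morphism: `mk a b` is sent to
`mk (α a) (α b)`. -/
def mapFun (α : SbalHom S T) : Env S → Env T :=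
  Quotient.map (fun p => (α.toFun p.1, α.toFun p.2)) (by
    rintro p q h
    change α.toFun p.1 + α.toFun q.2 = α.toFun p.2 + α.toFun q.1
    replace h : p.1 + q.2 = p.2 + q.1 := h
    rw [← α.map_add', h, α.map_add'])

theorem mapFun_mk (α : SbalHom S T) (a b : S) :
    mapFun α (mk a b) = mk (α.toFun a) (α.toFun b) := rfl

theorem mapFun_mk_pos (α : SbalHom S T) (a b : PosCone S) :
    mapFun α (mk a.1 b.1) = mk (α.pos a).1 (α.pos b).1 := rfl

theorem pos_add (α : SbalHom S T) (a b : PosCone S) : α.pos (a + b) = α.pos a + α.pos b :=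
  Subtype.ext (α.map_add' a.1 b.1)

/-- The homomorphism between envelopes induced by a morphism. -/
def map (α : SbalHom S T) : BalHom (Env S) (Env T) where
  toFun := mapFun α
  map_zero' := by rw [zero_def, mapFun_mk, α.map_zero]; rfl
  map_one' := by
    rw [one_def, mapFun_mk_pos, α.map_one']
    exact congrArg (mk _) α.map_zero
  map_add' := by
    refine ind fun a b => ind fun c d => ?_
    rw [mk_add, mapFun_mk, mapFun_mk, mapFun_mk, mk_add, α.map_add', α.map_add']
  map_mul' := by
    refine ind_pos fun a b => ind_pos fun c d => ?_
    rw [mk_mul, mapFun_mk_pos, mapFun_mk_pos, mapFun_mk_pos, mk_mul]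
    simp only [pos_add, α.map_mul']
  commutes' r := by
    rw [algebraMap_eq, algebraMap_eq, mapFun_mk, α.map_ρ, α.map_zero]
  map_sup' := by
    refine ind fun a b => ind fun c d => ?_
    rw [mk_sup, mapFun_mk, mapFun_mk, mapFun_mk, mk_sup]
    simp only [α.map_add', α.map_sup']
  map_inf' := by
    refine ind fun a b => ind fun c d => ?_
    rw [mk_inf, mapFun_mk, mapFun_mk, mapFun_mk, mk_inf]
    simp only [α.map_add', α.map_inf']

theorem map_prec (α : SbalHom S T) (x : Env S) (h : prec S x x) :
    prec T ((map α).toAlgHom x) ((map α).toAlgHom x) := by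
  obtain ⟨s, rfl⟩ := prec_self.1 h
  refine prec_self.2 ⟨α.toFun s, ?_⟩
  change mk (α.toFun s) (α.toFun 0) = mk (α.toFun s) 0
  rw [α.map_zero]

end map

end Env

/-- The contravariant functor from bounded archimedean `ℓ`-semialgebras to Nachbin spaces,
sending a semialgebra to the space of maximal `ℓ`-ideals of its envelope, with the order given by
the relation `Env.prec`, and `α` to the preimage map of the induced homomorphism of envelopes. -/
noncomputable def functorY : Sbal.{u}ᵒᵖ ⥤ Nach.{u} where
  obj S := spec (Env.isOrdering S.unop.carrier)
  map α := specMap _ _ (Env.map α.unop) (Env.map_prec α.unop)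
  map_id S := Nach.Hom.ext (funext fun x => MaxLIdeal.ext (by
    ext a
    induction a using Env.ind with
    | h a b => exact Iff.rfl))
  map_comp f g := Nach.Hom.ext (funext fun x => MaxLIdeal.ext (by
    ext a
    induction a using Env.ind with
    | h a b => exact Iff.rfl))

/-- If the envelope of `S` is a bounded archimedean `ℓ`-algebra, then `Env.prec` is a Nachbin
proximity on it, and `functorY` sends `S` to the value of `functorX` at the resulting pair. -/
theorem functorY_obj (S : Sbal.{u}) [IsBal (Env S.carrier)] :
    ∃ h : IsNachbinProximity (Env.prec S.carrier),
      functorY.obj (op S) = functorX.obj (op { carrier := Env S.carrier, prec := _, isNachbin := h }) := by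
  have e : Env.prec S.carrier = fun x y => ∃ s ∈ Set.range (Env.ε (S := S.carrier)), x ≤ s ∧ s ≤ y := by
    ext x y; simp [Env.prec]
  have h : IsReflexiveProximity (Env.prec S.carrier) := by
    rw [e]
    refine isReflexiveProximity_of_set _ ?_ ?_ ?_ ?_ ?_ ?_
    · exact fun r => ⟨ρ.toFun r, rfl⟩
    · rintro _ ⟨a, rfl⟩ _ ⟨b, rfl⟩
      exact ⟨a ⊔ b, (Env.ε_sup a b).symm⟩
    · rintro _ ⟨a, rfl⟩ _ ⟨b, rfl⟩
      exact ⟨a ⊓ b, by unfold Env.ε; rw [Env.mk_inf]; simp⟩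
    · rintro _ ⟨a, rfl⟩ _ ⟨b, rfl⟩
      exact ⟨a + b, by unfold Env.ε; rw [Env.mk_add, add_zero]⟩
    · rintro _ ⟨a, rfl⟩ _ ⟨b, rfl⟩ ha hb
      refine ⟨((⟨a, Env.nonneg_mk.1 ha⟩ : PosCone S.carrier) * ⟨b, Env.nonneg_mk.1 hb⟩).1, ?_⟩
      change _ = Env.mk (⟨a, Env.nonneg_mk.1 ha⟩ : PosCone S.carrier).1 (0 : PosCone S.carrier).1 *
        Env.mk (⟨b, Env.nonneg_mk.1 hb⟩ : PosCone S.carrier).1 (0 : PosCone S.carrier).1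
      rw [Env.mk_mul, mul_zero, zero_mul, mul_zero, add_zero, add_zero]; rfl
    · rintro r hr _ ⟨a, rfl⟩
      refine ⟨rsmul r hr a, ?_⟩
      unfold Env.ε
      rw [Env.smul_mk r hr]
      congr 1
      rw [rsmul_eq r hr 0 0 (by rw [ρ_zero, add_zero])]
      have : (⟨0 + ρ.toFun 0, by rw [ρ_zero, add_zero]⟩ : PosCone S.carrier) = 0 :=
        Subtype.ext (by change 0 + ρ.toFun 0 = (0 : S.carrier); rw [ρ_zero, add_zero])
      rw [this, mul_zero, mul_zero, neg_zero, ρ_zero]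
      exact (add_zero _).symm
  exact ⟨{ h with dense := (Env.isOrdering S.carrier).dense }, rfl⟩

end NachbinDuality

open NachbinDuality CategoryTheory Opposite

namespace NachbinDuality

/-! ### Isomorphisms of Nachbin spaces -/

/-! A maximal ℓ-ideal is the same thing as a unital ℓ-homomorphism to the reals: its quotient is the
real field (`MaxLIdeal.exists_sub_mem`), and conversely every such homomorphism has a maximal
ℓ-ideal as kernel (`MaxLIdeal.ofHom`). Points of the spectrum are therefore determined by their
values (`MaxLIdeal.val_ext`), the topology is the one induced by all evaluations
(`MaxLIdeal.isInducing_evals`), and by `below_subset_iff` the relation `x ≤ y` means that every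
reflexive element has at `x` at most its value at `y`.

In this language all functors dualise into the reals, and the two units of each adjunction are the
two readings of one pairing, the value of an element at a point. The element side sends `a` to the
function `x ↦ x.val a` (`gelfand`); reflexive elements become monotone functions because the order
was defined through them. Naturality and the triangle identities then amount to evaluating both
sides at an element, which is done with `MaxLIdeal.val_comap`, `val_etaHom` and `val_zetaHom`.

The substance is that `η` and `ζ` are isomorphisms, and both cases are instances of one criterion,
`isIso_toSpec`. Let an algebra act as continuous functions on a Nachbin space `X` so that only zero
vanishes everywhere, reflexive elements act as monotone functions, and every continuous monotone
function comes from a reflexive element. Then `X` is the spectrum. The order is reflected because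
continuous monotone functions detect the order of `X` (`exists_monotone_lt`, an ordered Urysohn
lemma), and injectivity follows by antisymmetry. For surjectivity, the image of `X` is compact,
hence closed, hence the set of points containing some ideal `I`; elements of `I` vanish on `X`, so
`I` is zero and the image is everything. A bijective, order-reflecting morphism from a compact to a
Hausdorff space is then an isomorphism.

This argument needs neither that the algebra is all of `C(X)` nor that it is dense there. It thus
covers `C(X)` and equally the envelope of the monotone functions, which embeds in `C(X)` by
`envCleHom`, usually as a proper subalgebra. It also needs only `IsWeakBal`, so the envelope need
not first be shown to be a bounded archimedean ℓ-algebra. -/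

/-- A bijective morphism of Nachbin spaces that reflects the order is an isomorphism. -/
theorem Nach.isIso_of_bijective {X Y : Nach.{u}} (f : X ⟶ Y)
    (hf : Function.Bijective (Nach.Hom.toFun f))
    (hle : ∀ x y, Nach.Hom.toFun f x ≤ Nach.Hom.toFun f y → x ≤ y) : IsIso f := by
  let e : X.carrier ≃ Y.carrier := Equiv.ofBijective _ hf
  have he : Continuous e := Nach.Hom.continuous f
  -- Continuity of the inverse is automatic: `X` is compact, and `Y` is Hausdorff because its
  -- partial order is closed.
  let g : Y ⟶ X :=
    Nach.Hom.mk e.symm (he.continuous_symm_of_equiv_compact_to_t2) fun a b h => hle _ _ (by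
      change e (e.symm a) ≤ e (e.symm b)
      rwa [e.apply_symm_apply, e.apply_symm_apply])
  exact ⟨g, Nach.Hom.ext (funext e.symm_apply_apply), Nach.Hom.ext (funext e.apply_symm_apply)⟩

/-! ### Recognising the space of maximal ℓ-ideals, and evaluating on it. -/

section Points

variable {A : Type u} [CommRing A] [Lattice A] [Algebra ℝ A] [IsWeakBal A]

/-- The topology defined by ℓ-ideals coincides with the one induced from the product of real lines,
so continuity can be tested one element at a time. -/
theorem MaxLIdeal.continuous_of_val {X : Type v} [TopologicalSpace X] {e : X → MaxLIdeal A}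
    (h : ∀ a, Continuous fun x => (e x).val a) : Continuous e :=
  isInducing_evals.continuous_iff.2 (continuous_pi h)

/-- A compact family of maximal `ℓ`-ideals that determines the zero element exhausts all
maximal `ℓ`-ideals. -/
theorem MaxLIdeal.surjective_of_eq_zero {X : Type v} [TopologicalSpace X] [CompactSpace X]
    [T2Space (MaxLIdeal A)] {e : X → MaxLIdeal A} (he : Continuous e)
    (h0 : ∀ a, (∀ x, (e x).val a = 0) → a = 0) : Function.Surjective e := by
  -- The image is compact in a Hausdorff space, hence closed, and closed sets are by definition of
  -- the form `Z I`. This takes the place of an approximation or separation argument.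
  obtain ⟨I, -, hI⟩ := (isClosed_iff _).1 (isCompact_range he).isClosed
  have hbot : ∀ a ∈ I, a = 0 := fun a ha => h0 a fun x => by
    have hx : e x ∈ Z I := hI ▸ Set.mem_range_self x
    exact ((e x).mem_iff a).1 (mem_Z.1 hx ha)
  -- Since `I` consists of zero alone, which lies in every ideal, `Z I` is the whole space.
  intro y
  have hy : y ∈ Set.range e := by
    rw [hI, mem_Z]
    intro a ha
    rw [hbot a ha]
    exact y.ideal.zero_mem
  exact hy

variable {prec : A → A → Prop} (hp : IsOrdering prec)

/-- A family of real homomorphisms of an algebra, continuous in its parameter and monotone in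
its parameter on reflexive elements, as a morphism to the space of maximal `ℓ`-ideals. -/
def toSpec {X : Nach.{u}} (e : X.carrier → BalHom A ℝ)
    (hc : ∀ a, Continuous fun x => (e x).toAlgHom a)
    (hm : ∀ c, prec c c → Monotone fun x => (e x).toAlgHom c) : X ⟶ spec hp where
  toFun x := MaxLIdeal.ofHom (e x)
  continuous := MaxLIdeal.continuous_of_val fun a => by
    simpa only [MaxLIdeal.val_ofHom] using hc a
  monotone := fun x y h => (below_subset_iff hp _ _).2 fun c hcc => by
    rw [MaxLIdeal.val_ofHom, MaxLIdeal.val_ofHom]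
    exact hm c hcc h

/-- The morphism of `toSpec` is an isomorphism if its values are jointly injective and the
monotone functions arise from reflexive elements. -/
theorem isIso_toSpec {X : Nach.{u}} (e : X.carrier → BalHom A ℝ)
    (hc : ∀ a, Continuous fun x => (e x).toAlgHom a)
    (hm : ∀ c, prec c c → Monotone fun x => (e x).toAlgHom c)
    (h0 : ∀ a, (∀ x, (e x).toAlgHom a = 0) → a = 0)
    (hr : ∀ f : C(X.carrier, ℝ), Monotone f →
      ∃ c, prec c c ∧ ∀ x, (e x).toAlgHom c = f x) : IsIso (toSpec hp e hc hm) := by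
  have hle : ∀ x y, Nach.Hom.toFun (toSpec hp e hc hm) x ≤ Nach.Hom.toFun (toSpec hp e hc hm) y →
      x ≤ y := fun x y h => by
    -- If the order failed in `X`, a continuous monotone `f` would witness it. The reflexive element
    -- behind `f` then contradicts the order of the images, which compares values at reflexive
    -- elements.
    by_contra hxy
    obtain ⟨f, hf, hlt⟩ := exists_monotone_lt X hxy
    obtain ⟨c, hcc, hcf⟩ := hr f hf
    have h1 := (below_subset_iff hp (MaxLIdeal.ofHom (e x)) (MaxLIdeal.ofHom (e y))).1 h c hcc
    rw [MaxLIdeal.val_ofHom, MaxLIdeal.val_ofHom, hcf, hcf] at h1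
    exact hlt.not_ge h1
  -- Injectivity is order reflection in both directions followed by antisymmetry in `X`.
  refine Nach.isIso_of_bijective _ ⟨fun x y h => le_antisymm (hle x y h.le) (hle y x h.ge), ?_⟩ hle
  -- The carrier of `spec hp` is `MaxLIdeal A` with the same topology, and the closed order on `spec
  -- hp` makes it Hausdorff.
  have : T2Space (MaxLIdeal A) := inferInstanceAs (T2Space (spec hp).carrier)
  exact MaxLIdeal.surjective_of_eq_zero (Nach.Hom.continuous (toSpec hp e hc hm))
    fun a ha => h0 a fun x => by
      rw [← MaxLIdeal.val_ofHom]
      exact ha x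

/-- The element `a` as a continuous function on the space of maximal `ℓ`-ideals. -/
noncomputable def gelfand (a : A) : C(MaxLIdeal A, ℝ) :=
  ⟨fun x => x.val a, MaxLIdeal.continuous_val a⟩

/-- By `below_subset_iff` the order on the spectrum is comparison of values at reflexive elements.
This is what makes both units land in the right place: `φ` preserves proximity and `ψ` takes
monotone values. -/
theorem gelfand_monotone {c : A} (hc : prec c c) :
    Monotone (α := (spec hp).carrier) (gelfand c) :=
  fun x y h => (below_subset_iff hp x y).1 h c hc

/-- The map `gelfand` as a homomorphism. -/
noncomputable def gelfandHom (A : Type u) [CommRing A] [Lattice A] [Algebra ℝ A] [IsWeakBal A] :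
    BalHom A C(MaxLIdeal A, ℝ) where
  toFun := gelfand
  map_one' := ContinuousMap.ext fun x => x.val_one
  map_mul' a b := ContinuousMap.ext fun x => x.val_mul a b
  map_zero' := ContinuousMap.ext fun x => x.val_zero
  map_add' a b := ContinuousMap.ext fun x => x.val_add a b
  commutes' r := ContinuousMap.ext fun x => x.val_algebraMap r
  map_sup' a b := ContinuousMap.ext fun x => x.val_sup a b
  map_inf' a b := ContinuousMap.ext fun x => x.val_inf a b

end Points

/-- Evaluation at a point. -/
def evalHom {X : Type u} [TopologicalSpace X] (x : X) : BalHom C(X, ℝ) ℝ where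
  toFun f := f x
  map_one' := rfl
  map_mul' _ _ := rfl
  map_zero' := rfl
  map_add' _ _ := rfl
  commutes' _ := rfl
  map_sup' _ _ := rfl
  map_inf' _ _ := rfl

/-! ### The adjunction between Nachbin spaces and algebras with a Nachbin proximity -/

/-- The morphism that sends a point to the functions vanishing there. -/
def etaHom (X : Nach.{u}) : X ⟶ spec (precC_isNachbinProximity X).isOrdering :=
  toSpec (precC_isNachbinProximity X).isOrdering evalHom (fun f => f.continuous)
    fun _ hc => precC_self.1 hc

/-- The working description of `η`: since ideals are compared through their values, this formula
replaces its definition as a kernel in all later checks. -/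
theorem val_etaHom (X : Nach.{u}) (x : X.carrier) (f : C(X.carrier, ℝ)) :
    MaxLIdeal.val (A := C(X.carrier, ℝ)) (Nach.Hom.toFun (etaHom X) x) f = f x :=
  MaxLIdeal.val_ofHom _ f

/-- Both conditions of `isIso_toSpec` are immediate here: functions are determined by their values,
and a monotone function is itself reflexive by `precC_self`. -/
instance (X : Nach.{u}) : IsIso (etaHom X) :=
  isIso_toSpec _ _ _ _ (fun _ h => ContinuousMap.ext h)
    fun f hf => ⟨f, precC_self.2 hf, fun _ => rfl⟩

/-- The natural isomorphism of a Nachbin space with the space of maximal `ℓ`-ideals of its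
algebra of continuous functions. -/
noncomputable def etaIso : 𝟭 Nach.{u} ≅ functorC.{u}.rightOp ⋙ functorX.{u} :=
  NatIso.ofComponents (fun X => (asIso (etaHom X) :)) fun {X Y} φ =>
    Nach.Hom.ext (funext fun x => MaxLIdeal.val_ext (A := C(Y.carrier, ℝ)) fun f => by
      -- Both ideals give `f` the value of `f` at the image of `x` under `φ`; on the right this
      -- arises by first pulling `f` back along `φ`.
      refine (val_etaHom Y _ f).trans (Eq.trans ?_ (MaxLIdeal.val_comap _ _ f).symm)
      exact (val_etaHom X x (f.comp ⟨Nach.Hom.toFun φ, Nach.Hom.continuous φ⟩)).symm)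

/-- The morphism from an algebra with a Nachbin proximity to the continuous functions on its space
of maximal `ℓ`-ideals. -/
noncomputable def phiHom (A : Nbal.{u}) : A ⟶ functorC.obj (op (functorX.obj (op A))) where
  hom := gelfandHom A.carrier
  map_prec a b h := by
    -- The reflexivity axiom enters here: the proximity on continuous functions requires a monotone
    -- function in between, and a reflexive interpolant provides one.
    obtain ⟨c, hc, hac, hcb⟩ := A.isNachbin.exists_reflexive a b h
    exact ⟨gelfand c, gelfand_monotone A.isNachbin.isOrdering hc,
      fun x => x.val_mono (A.isNachbin.le _ _ hac), fun x => x.val_mono (A.isNachbin.le _ _ hcb)⟩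

/-- The contravariant adjunction between `functorX` and `functorC`. -/
noncomputable def adjunctionXC : functorX.{u}.rightOp ⊣ functorC.{u} where
  unit :=
    { app := phiHom
      naturality := fun _ B α => Nbal.Hom.ext (BalHom.ext (funext fun a =>
        ContinuousMap.ext fun (x : MaxLIdeal B.carrier) =>
          (MaxLIdeal.val_comap α.hom x a).symm)) }
  -- The left adjoint takes values in the opposite of `Nach`, so the counit at `op X` is `η` at `X`
  -- read backwards, and its naturality square is the flipped one of `etaIso`.
  counit :=
    { app := fun X => (etaHom X.unop).op
      naturality := fun _ _ φ => congrArg Quiver.Hom.op (etaIso.hom.naturality φ.unop).symm }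
  -- Pulling back the point `η x` of the double dual along `φ` gives `a` the value of the function
  -- `φ a` at `x`, which is `x.val a`.
  left_triangle_components A := Quiver.Hom.unop_inj (Nach.Hom.ext (funext fun x =>
    MaxLIdeal.val_ext (A := A.carrier) fun a =>
      (MaxLIdeal.val_comap _ _ a).trans (val_etaHom _ x _)))
  -- Conversely, the function `φ f` takes at `η x` the value of `f` at `x`.
  right_triangle_components X := Nbal.Hom.ext (BalHom.ext (funext fun f =>
    ContinuousMap.ext fun x => val_etaHom X.unop x f))

/-! ### The adjunction between Nachbin spaces and semialgebras -/

/-! ### The envelope of the monotone functions as an algebra of functions on `X`. -/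

section Envelope

variable (X : Nach.{u})

/-- The function that sends the formal difference of two functions to their difference. -/
def envCleFun : Env (Cle X) → C(X.carrier, ℝ) :=
  Quotient.lift (fun p => p.1.1 - p.2.1) fun p q (h : p.1 + q.2 = p.2 + q.1) => by
    have h' : p.1.1 + q.2.1 = p.2.1 + q.1.1 := congrArg Subtype.val h
    change p.1.1 - p.2.1 = q.1.1 - q.2.1
    rw [sub_eq_sub_iff_add_eq_add, h', add_comm]

/-- The envelope of the continuous order-preserving functions inside the continuous functions. -/
noncomputable def envCleHom : BalHom (Env (Cle X)) C(X.carrier, ℝ) where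
  toFun := envCleFun X
  -- The unit, zero and the reals of the envelope are all formal differences with second entry zero,
  -- so each of these goals unfolds to a subtraction of zero.
  map_one' := sub_zero _
  map_zero' := sub_zero _
  map_add' := by
    refine Env.ind fun f g => Env.ind fun f' g' => ?_
    exact add_sub_add_comm f.1 f'.1 g.1 g'.1
  map_mul' := by
    -- The product in the envelope has an explicit formula only on nonnegative representatives.
    refine Env.ind_pos fun f g => Env.ind_pos fun f' g' => ?_
    rw [Env.mk_mul]
    change (f.1.1 * f'.1.1 + g.1.1 * g'.1.1) - (f.1.1 * g'.1.1 + g.1.1 * f'.1.1) =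
      (f.1.1 - g.1.1) * (f'.1.1 - g'.1.1)
    ring
  commutes' r := sub_zero (ContinuousMap.const _ r)
  map_sup' := by
    refine Env.ind fun f g => Env.ind fun f' g' => ?_
    -- The join of formal differences is formed after adding `g + g'` to both; subtracting that sum
    -- again recovers the pointwise maximum. Meets below work the same way.
    rw [Env.mk_sup]
    ext x
    change max (f.1 x + g'.1 x) (f'.1 x + g.1 x) - (g.1 x + g'.1 x) =
      max (f.1 x - g.1 x) (f'.1 x - g'.1 x)
    rw [← max_sub_sub_right]
    congr 1 <;> ring
  map_inf' := by
    refine Env.ind fun f g => Env.ind fun f' g' => ?_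
    rw [Env.mk_inf]
    ext x
    change min (f.1 x + g'.1 x) (f'.1 x + g.1 x) - (g.1 x + g'.1 x) =
      min (f.1 x - g.1 x) (f'.1 x - g'.1 x)
    rw [← min_sub_sub_right]
    congr 1 <;> ring

/-- A formal difference is determined by the actual difference of functions, because addition of
functions is cancellative. This is the condition that only zero vanishes everywhere. -/
theorem envCleHom_injective {a : Env (Cle X)} (h : (envCleHom X).toAlgHom a = 0) : a = 0 := by
  induction a using Env.ind with
  | h f g =>
    have hfg : f = g := Subtype.ext (sub_eq_zero.1 h)
    rw [hfg, Env.zero_def, Env.mk_eq]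

/-- The reflexive elements of the envelope are precisely the images of `Env.ε` (`Env.prec_self`),
that is, the monotone functions themselves. -/
theorem envCleHom_monotone {c : Env (Cle X)} (hc : Env.prec (Cle X) c c) :
    Monotone ((envCleHom X).toAlgHom c) := fun x y h => by
  obtain ⟨s, rfl⟩ := Env.prec_self.1 hc
  change s.1 x - 0 ≤ s.1 y - 0
  rw [sub_zero, sub_zero]
  exact s.2 h

/-- The morphism that sends a point to the formal differences of functions that agree there. -/
noncomputable def zetaHom : X ⟶ spec (Env.isOrdering (Cle X)) :=
  toSpec (Env.isOrdering (Cle X)) (fun x => (evalHom x).comp (envCleHom X))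
    (fun a => ((envCleHom X).toAlgHom a).continuous) fun _ hc => envCleHom_monotone X hc

theorem val_zetaHom (x : X.carrier) (f g : Cle X) :
    MaxLIdeal.val (A := Env (Cle X)) (Nach.Hom.toFun (zetaHom X) x) (Env.mk f g) =
      f.1 x - g.1 x :=
  MaxLIdeal.val_ofHom _ (Env.mk f g)

/-- A monotone `f` comes from the reflexive element `Env.ε f`, so `isIso_toSpec` applies directly to
the envelope, without comparing its spectrum with that of `C(X)`. -/
instance : IsIso (zetaHom X) :=
  isIso_toSpec _ _ _ _ (fun _ h => envCleHom_injective X (ContinuousMap.ext h))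
    fun f hf => ⟨Env.ε ⟨f, hf⟩, Env.prec_self.2 ⟨_, rfl⟩, fun x => sub_zero (f x)⟩

end Envelope

/-- The natural isomorphism of a Nachbin space with the space of maximal `ℓ`-ideals of the envelope
of its semialgebra of continuous order-preserving functions. -/
noncomputable def zetaIso : 𝟭 Nach.{u} ≅ functorCle.{u}.rightOp ⋙ functorY.{u} :=
  NatIso.ofComponents (fun X => (asIso (zetaHom X) :)) fun {X Y} φ =>
    Nach.Hom.ext (funext fun x => MaxLIdeal.val_ext (A := Env (Cle Y)) fun a => by
      induction a using Env.ind with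
      | h f g =>
        refine (val_zetaHom Y _ f g).trans (Eq.trans ?_ (MaxLIdeal.val_comap _ _ _).symm)
        -- The induced map of envelopes acts on representatives by `α`, composition with `φ`, so
        -- both sides are the difference of `f` and `g` at the image of `x`.
        let α : SbalHom (Cle Y) (Cle X) := functorCle.map φ.op
        exact (val_zetaHom X x (α.toFun f) (α.toFun g)).symm)

/-! ### The embedding into the envelope and the unit at a semialgebra. -/

theorem Env.ε_add {S : Type u} [SbalAlg S] (a b : S) : ε (a + b) = ε a + ε b := by
  unfold ε; rw [mk_add, add_zero]

theorem Env.ε_inf {S : Type u} [SbalAlg S] (a b : S) : ε (a ⊓ b) = ε a ⊓ ε b := by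
  unfold ε; rw [mk_inf]; simp

/-- With both second entries zero, three of the four terms in the product formula vanish. -/
theorem Env.ε_mul {S : Type u} [SbalAlg S] (a b : PosCone S) :
    ε (a * b).1 = ε a.1 * ε b.1 := by
  change mk _ _ = mk a.1 (0 : PosCone S).1 * mk b.1 (0 : PosCone S).1
  rw [mk_mul, mul_zero, mul_zero, zero_mul, add_zero, add_zero]; rfl

/-- `Env.eq_ε_sub` only asserts that some representatives exist; the triangle identity needs the
given ones. -/
theorem Env.mk_eq_ε_sub {S : Type u} [SbalAlg S] (a b : S) : mk a b = ε a - ε b := by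
  unfold ε; rw [sub_eq_add_neg, neg_mk, mk_add, add_zero, zero_add]

/-- The morphism from a semialgebra to the continuous order-preserving functions on the space of
maximal `ℓ`-ideals of its envelope. -/
noncomputable def psiHom (S : Sbal.{u}) : S ⟶ functorCle.obj (op (functorY.obj (op S))) :=
  -- `ψ` is the composite of `Env.ε` with `gelfandHom`, so each law joins a law of one with a law of
  -- the other. `ofMapρ` derives compatibility with the action from compatibility with the reals.
  SbalHom.ofMapρ (T := Cle (functorY.obj (op S)))
    { toFun := fun s => ⟨gelfand (Env.ε s),
        gelfand_monotone (Env.isOrdering S.carrier) (Env.prec_self.2 ⟨s, rfl⟩)⟩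
      map_add' := fun a b => Subtype.ext 
        ((congrArg gelfand (Env.ε_add a b)).trans (map_add (gelfandHom _).toAlgHom _ _))
      map_sup' := fun a b => Subtype.ext 
        ((congrArg gelfand (Env.ε_sup a b).symm).trans ((gelfandHom _).map_sup _ _))
      map_inf' := fun a b => Subtype.ext 
        ((congrArg gelfand (Env.ε_inf a b)).trans ((gelfandHom _).map_inf _ _)) }
    (Subtype.ext (Subtype.ext (map_one (gelfandHom _).toAlgHom)))
    (fun a b => Subtype.ext (Subtype.ext 
      ((congrArg gelfand (Env.ε_mul a b)).trans (map_mul (gelfandHom _).toAlgHom _ _))))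
    (fun r => Subtype.ext ((gelfandHom (Env S.carrier)).toAlgHom.commutes r))

/-- The contravariant adjunction between `functorY` and `functorCle`. -/
noncomputable def adjunctionYCle : functorY.{u}.rightOp ⊣ functorCle.{u} where
  unit :=
    { app := psiHom
      naturality := fun S T α => SbalHom.ext (funext fun s => Subtype.ext
        (ContinuousMap.ext fun (y : MaxLIdeal (Env T.carrier)) => by
          refine Eq.trans ?_ (MaxLIdeal.val_comap (Env.map α) y (Env.ε s)).symm
          -- The induced map sends `Env.ε s` to a formal difference with second entry `α 0`.
          -- Preservation of zero is not among the axioms for morphisms; it follows from additivity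
          -- by cancellation.
          change y.val (Env.mk _ 0) = y.val (Env.mk _ (α.toFun 0))
          rw [α.map_zero]; rfl)) }
  counit :=
    { app := fun X => (zetaHom X.unop).op
      naturality := fun _ _ φ => congrArg Quiver.Hom.op (zetaIso.hom.naturality φ.unop).symm }
  left_triangle_components S := Quiver.Hom.unop_inj (Nach.Hom.ext (funext fun y =>
    MaxLIdeal.val_ext (A := Env S.carrier) fun a => by
      induction a using Env.ind with
      | h b c =>
        -- The value at the class of `(b, c)` becomes `ψ b - ψ c` at `y`, that is, the difference of
        -- the values of `Env.ε b` and `Env.ε c`.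
        refine (MaxLIdeal.val_comap _ _ _).trans ((val_zetaHom _ y _ _).trans ?_)
        exact (MaxLIdeal.val_sub _ _ _).symm.trans (congrArg _ (Env.mk_eq_ε_sub b c).symm)))
  -- `Env.ε f` is the class of `(f, 0)`, which accounts for the subtracted zero.
  right_triangle_components X := SbalHom.ext (funext fun f => Subtype.ext
    (ContinuousMap.ext fun x => (val_zetaHom X.unop x f 0).trans (sub_zero _)))

end NachbinDuality

/-- Membership of `a - r` in `x` determines `r` by `MaxLIdeal.val_eq`, so the membership clauses
specify the units completely. The annotations `F :=` and `A :=` expose function spaces and algebras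
that are visible only after unfolding the functors. -/
theorem mainTheorem4 :
    (∃ (adj : functorX.{u}.rightOp ⊣ functorC.{u})
        (η : 𝟭 Nach.{u} ≅ functorC.{u}.rightOp ⋙ functorX.{u}),
      (∀ X : Nach.{u}, (adj.counit.app (op X)).unop = η.hom.app X) ∧
      (∀ (A : Nbal.{u}) (a : A.carrier) (x : MaxLIdeal A.carrier),
        a - algebraMap ℝ A.carrier
          (DFunLike.coe (F := C(MaxLIdeal A.carrier, ℝ))
            ((adj.unit.app A).hom.toAlgHom a) x) ∈ x.ideal) ∧
      (∀ (X : Nach.{u}) (x : X.carrier) (f : C(X.carrier, ℝ)),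
        f ∈ MaxLIdeal.ideal (A := C(X.carrier, ℝ)) ((η.hom.app X).toFun x) ↔ f x = 0)) ∧
    (∃ (adj : functorY.{u}.rightOp ⊣ functorCle.{u})
        (ζ : 𝟭 Nach.{u} ≅ functorCle.{u}.rightOp ⋙ functorY.{u}),
      (∀ X : Nach.{u}, (adj.counit.app (op X)).unop = ζ.hom.app X) ∧
      (∀ (S : Sbal.{u}) (s : S.carrier) (y : MaxLIdeal (Env S.carrier)),
        Env.ε s - algebraMap ℝ (Env S.carrier)
          (DFunLike.coe (F := C(MaxLIdeal (Env S.carrier), ℝ))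
            ((adj.unit.app S).toFun s).1 y) ∈ y.ideal) ∧
      (∀ (X : Nach.{u}) (x : X.carrier) (f g : Cle X),
        Env.mk f g ∈ MaxLIdeal.ideal (A := Env (Cle X)) ((ζ.hom.app X).toFun x) ↔
          f.1 x = g.1 x)) := by
  -- Counits and natural isomorphisms were built from the same components, so they agree by `rfl`.
  -- The defining property of `MaxLIdeal.val` settles the clauses on `φ` and `ψ`; what remains is
  -- that lying in the ideal means having value zero.
  refine ⟨⟨adjunctionXC, etaIso, fun _ => rfl, fun A a x => x.sub_val_mem a, fun X x f => ?_⟩,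
    adjunctionYCle, zetaIso, fun _ => rfl, fun S s y => y.sub_val_mem (Env.ε s), fun X x f g => ?_⟩
  · refine (MaxLIdeal.mem_iff _ f).trans ?_
    change MaxLIdeal.val (A := C(X.carrier, ℝ)) (Nach.Hom.toFun (etaHom X) x) f = 0 ↔ _
    rw [val_etaHom]
  · refine (MaxLIdeal.mem_iff _ _).trans ?_
    change MaxLIdeal.val (A := Env (Cle X)) (Nach.Hom.toFun (zetaHom X) x) (Env.mk f g) = 0 ↔ _
    rw [val_zetaHom, sub_eq_zero]
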